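/- Let $d\ge 2$, let $\mathbb T^d=\mathbb R^d/(2\pi\mathbb Z)^d$ be the flat torus with normalized volume measure $dx$ (total mass $1$), and let $\mu$ be a Borel probability measure on $\mathbb T^d$ with Fourier coefficients $\hat\mu(n)=\int_{\mathbb T^d}e^{-in\cdot x}\,d\mu(x)$, $n\in\mathbb Z^d$. Suppose that there are $\alpha>d-2$ and $C>0$ such that $$|\hat\mu(n)|^2\le C\,\|n\|^{-\alpha}\qquad\text{for all } n\in\mathbb Z^d\setminus\{0\},$$ where $\|\cdot\|$ is the Euclidean norm. Then for every orthonormal basis $(\psi_j)_{j\ge 1}$ of $L^2(\mathbb T^d,dx)$ consisting of (smooth, complex-valued) Laplace eigenfunctions, $-\Delta\psi_j=\lambda_j^2\psi_j$, enumerated so that $0\le\lambda_1\le\lambda_2\le\cdots$, there exists a set $S\subset\{1,2,3,\dots\}$ of density one, i.e. $\frac1N|\{j\in S: j\le N\}|\to 1$ as $N\to\infty$, such that for every continuous function $a:\mathbb T^d\to\mathbb C$, $$\lim_{j\to\infty,\ j\in S}\int_{\mathbb T^d}a\,|\psi_j|^2\,d\mu=\int_{\mathbb T^d}a\,d\mu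 .$$ -/

import Mathlib

open MeasureTheory Filter Topology
open scoped Real

namespace ToralQE

/-- The flat torus `𝕋^d = ℝ^d / (2πℤ)^d`. -/
abbrev Torus (d : ℕ) : Type := Fin d → AddCircle (2 * π)

/-- The period `2π` is positive; needed for the Haar measure on `ℝ / 2πℤ`. -/
instance factTwoPiPos : Fact (0 < 2 * π) := ⟨Real.two_pi_pos⟩

/-- The normalized volume measure `dx` on `𝕋^d` (total mass `1`). -/
noncomputable def normVol (d : ℕ) : Measure (Torus d) :=
  Measure.pi fun _ => AddCircle.haarAddCircle

instance normVol_isProbabilityMeasure (d : ℕ) : IsProbabilityMeasure (normVol d) := by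
  unfold normVol; infer_instance

/-- The covering map `ℝ^d → 𝕋^d`; it is a local isometry for the flat metric. -/
noncomputable def proj (d : ℕ) (x : EuclideanSpace ℝ (Fin d)) : Torus d := fun i => (x i : AddCircle (2 * π))

/-- `ψ` is a smooth function on `𝕋^d` with `-Δψ = lam² ψ`. Smoothness and the Laplacian are those
of the periodic lift to Euclidean space. -/
def IsLaplaceEigenfunction {d : ℕ} (ψ : C(Torus d, ℂ)) (lam : ℝ) : Prop :=
  ContDiff ℝ (⊤ : ℕ∞) (fun x => ψ (proj d x)) ∧
    ∀ x : EuclideanSpace ℝ (Fin d),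
      -(Laplacian.laplacian (fun y : EuclideanSpace ℝ (Fin d) => ψ (proj d y)) x)
        = ((lam ^ 2 : ℝ) : ℂ) * ψ (proj d x)

/-- `(ψ_j)` is an orthonormal basis of `L²(𝕋^d, dx)` made of Laplace eigenfunctions,
`-Δψ_j = λ_j² ψ_j`, enumerated so that `0 ≤ λ_0 ≤ λ_1 ≤ ⋯`.
(Indices start at `0`, so `ψ j` is the `(j+1)`-st element of the basis.) -/
structure IsEigenbasis {d : ℕ} (ψ : ℕ → C(Torus d, ℂ)) (lam : ℕ → ℝ) : Prop where
  nonneg : ∀ j, 0 ≤ lam j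
  mono : Monotone lam
  eigen : ∀ j, IsLaplaceEigenfunction (ψ j) (lam j)
  orthonormal : Orthonormal ℂ fun j => ContinuousMap.toLp (E := ℂ) 2 (normVol d) ℂ (ψ j)
  complete : (Submodule.span ℂ
    (Set.range fun j => ContinuousMap.toLp (E := ℂ) 2 (normVol d) ℂ (ψ j))).topologicalClosure = ⊤

/-- The exponential `x ↦ exp (i n·x)` on `𝕋^d`, for `n ∈ ℤ^d`. -/
noncomputable def expMonomial {d : ℕ} (n : Fin d → ℤ) (x : Torus d) : ℂ :=
  ∏ i, fourier (n i) (x i)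

/-- The Fourier coefficient `μ̂(n) = ∫ exp (-i n·x) dμ(x)`. -/
noncomputable def fourierCoeffMeasure {d : ℕ} (μ : Measure (Torus d)) (n : Fin d → ℤ) : ℂ :=
  ∫ x, expMonomial (-n) x ∂μ

/-- The Euclidean norm of a lattice point. -/
noncomputable def latticeNorm {d : ℕ} (n : Fin d → ℤ) : ℝ :=
  √(∑ i, (n i : ℝ) ^ 2)

/-- `S ⊆ ℕ` has density one: the proportion of the first `N` indices lying in `S` tends to `1`. -/
def HasDensityOne (S : Set ℕ) : Prop :=
  Tendsto (fun N : ℕ => ((S ∩ Set.Iio N).ncard : ℝ) / N) atTop (𝓝 1)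

end ToralQE

/-!
Write `ψ_j = ∑ c_j(n) e_n` in exponentials `e_n(x) = exp (i n·x)`. Integration by parts on the torus
shows that only the `n` with `|n| = λ_j` occur (`inner_expMap_eq_zero`). Hence
`∫ e_l |ψ_j|² dμ - ∫ e_l dμ` is the quadratic form at `c_j` of the matrix `T` with entries
`μ̂(n - m - l)` for `n ≠ m`, `|n| = |m|`, and zero elsewhere: the diagonal terms add up to
`∫ e_l dμ` because `ψ_j` has norm one. As the `ψ_j` are orthonormal, the Cauchy–Schwarz and Bessel
inequalities bound the sum over `j < N` of the squares of these forms by the squared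
Hilbert–Schmidt norm of `T`, restricted to a cube of side about `2 λ_N`
(`IsEigenbasis.sum_variance_le`).

Everything thus reduces to lattice points. A pair of points `n`, `m = n - k` of equal norm satisfies
`2 n · k = |k|²`, so that for each `k` one counts the points of a hyperplane section of the cube
`[-P, P]^d`. If `k_j` is the largest coordinate of `k` and `i ≠ j`, there are
`O(P ^ (d - 1) gcd(k_j, k_i) / |k_j|)` of them (`card_hyperplane_le`). Summing this against
`|μ̂(k - l)|² ≪ |k_j| ^ (-α)` leaves `P ^ (d - 1)` times the sum of `m ^ (-(α - (d - 2))) τ(m)` over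
`m ≤ 2 P`, which is `o(P ^ d)` because `α > d - 2` (`sum_equal_norm_pairs_le`). On the other
hand `N ≫ P ^ d` by counting dimensions (`IsEigenbasis.pow_le_index`), so that the variance is
`o(N)` for every `l` (`cesaro_variance_tendsto`).

The Koopman–von Neumann lemma, applied to all `l ∈ ℤ^d` at once
(`exists_densityOne_of_forall_cesaro`), gives a set of density one along which
`∫ e_l |ψ_j|² dμ → ∫ e_l dμ` for every `l`. Trigonometric polynomials being uniformly dense and the
masses `∫ |ψ_j|² dμ` bounded along this set (the case `l = 0`), the limit holds for all continuous
functions (`tendsto_integral_of_expMonomial`).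
-/

namespace ToralQE

/-! ### Lattice points on hyperplanes and sums of divisors -/

/-- A residue class modulo `q` has at most `2 P / q + 1` elements in `[-P, P]`. -/
theorem card_le_of_dvd_sub {P q : ℕ} (hq : 0 < q) {s : Finset ℤ}
    (hs : s ⊆ Finset.Icc (-P : ℤ) P) (h : ∀ x ∈ s, ∀ y ∈ s, (q : ℤ) ∣ x - y) :
    s.card ≤ 2 * P / q + 1 := by
  have hq' : (0 : ℤ) < q := by exact_mod_cast hq
  rw [← Finset.card_range (2 * P / q + 1)]
  refine Finset.card_le_card_of_injOn (fun x => ((x + P) / q).toNat) ?_ ?_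
  · intro x hx
    have hx' := Finset.mem_Icc.1 (hs hx)
    have h1 : (x + P) / (q : ℤ) ≤ (2 * P) / (q : ℤ) := Int.ediv_le_ediv hq' (by linarith)
    have h2 : 0 ≤ (x + P) / (q : ℤ) := Int.ediv_nonneg (by linarith) hq'.le
    have h3 : ((2 * P / q : ℕ) : ℤ) = (2 * P) / (q : ℤ) := by push_cast; rfl
    simp only [Finset.coe_range, Set.mem_Iio]
    omega
  · intro x hx y hy hxy
    have hx' := Finset.mem_Icc.1 (hs hx)
    have hy' := Finset.mem_Icc.1 (hs hy)
    have h2 : 0 ≤ (x + P) / (q : ℤ) := Int.ediv_nonneg (by linarith) hq'.le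
    have h2' : 0 ≤ (y + P) / (q : ℤ) := Int.ediv_nonneg (by linarith) hq'.le
    have hq2 : (x + P) / (q : ℤ) = (y + P) / (q : ℤ) := by
      simp only at hxy; omega
    have hm : (x + P) % (q : ℤ) = (y + P) % (q : ℤ) := by
      rw [Int.emod_eq_emod_iff_emod_sub_eq_zero]
      apply Int.emod_eq_zero_of_dvd
      simpa using h x hx y hy
    have e1 := Int.emod_add_mul_ediv (x + P) q
    have e2 := Int.emod_add_mul_ediv (y + P) q
    rw [hq2, hm] at e1
    linarith

/-- The cube of lattice points all of whose coordinates have absolute value at most `P`. -/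
noncomputable def box (d P : ℕ) : Finset (Fin d → ℤ) :=
  Fintype.piFinset fun _ => Finset.Icc (-P : ℤ) P

theorem mem_box {d P : ℕ} {n : Fin d → ℤ} : n ∈ box d P ↔ ∀ i, |n i| ≤ P := by
  simp [box, abs_le]

theorem card_box_fiber_le {d P : ℕ} {i j : Fin d} (hij : i ≠ j) (x y : ℤ) :
    ((box d P).filter fun n => n i = x ∧ n j = y).card ≤ (2 * P + 1) ^ (d - 2) := by
  classical
  have hsub : ((box d P).filter fun n => n i = x ∧ n j = y) ⊆
      Fintype.piFinset fun l => if l = i then {x} else if l = j then {y}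
        else Finset.Icc (-P : ℤ) P := by
    intro n hn
    simp only [box, Finset.mem_filter, Fintype.mem_piFinset] at hn ⊢
    intro l
    split_ifs with h1 h2
    · simp [h1, hn.2.1]
    · simp [h2, hn.2.2]
    · exact hn.1 l
  refine (Finset.card_le_card hsub).trans_eq ?_
  rw [Fintype.card_piFinset, ← Finset.mul_prod_erase _ _ (Finset.mem_univ i),
    ← Finset.mul_prod_erase _ _ (Finset.mem_erase.2 ⟨hij.symm, Finset.mem_univ j⟩)]
  rw [Finset.prod_congr rfl (g := fun _ => 2 * P + 1)]
  · simp [hij.symm, Finset.card_erase_of_mem, Nat.sub_sub]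
  · intro l hl
    simp only [Finset.mem_erase] at hl
    rw [if_neg hl.2.1, if_neg hl.1, Int.card_Icc]
    omega

/-- A hyperplane section of the cube: once the coordinates other than `i` and `j` are fixed, `n i` is
determined modulo `k j / gcd (k j) (k i)`, and it determines `n j`. -/
theorem card_hyperplane_le {d P : ℕ} {i j : Fin d} (hij : i ≠ j) (k : Fin d → ℤ) (hj : k j ≠ 0)
    (hP : |k j| ≤ 2 * P) (c : ℤ) :
    (((box d P).filter fun n => 2 * ∑ l, n l * k l = c).card : ℝ) ≤
      (2 * P + 1) ^ (d - 2) * (4 * P * (k j).gcd (k i) / |(k j : ℝ)|) := by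
  classical
  set g := (k j).gcd (k i) with hg
  have hg0 : 0 < g := Int.gcd_pos_of_ne_zero_left _ hj
  obtain ⟨a, b, hab, ha, hb⟩ := Int.exists_gcd_one (m := k j) (n := k i) hg0
  rw [← hg] at ha hb
  clear_value g
  have hga : (k j).natAbs = a.natAbs * g := by
    conv_lhs => rw [ha, Int.natAbs_mul, Int.natAbs_natCast]
  have ha0 : 0 < a.natAbs := by
    rw [Int.natAbs_pos]; rintro rfl; exact hj (by rw [ha, zero_mul])
  -- the fibres of the map that forgets the coordinates `i` and `j`
  have key : ((box d P).filter fun n => 2 * ∑ l, n l * k l = c).card ≤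
      (2 * P / a.natAbs + 1) * (2 * P + 1) ^ (d - 2) := by
    set s := (box d P).filter fun n => 2 * ∑ l, n l * k l = c
    let F : (Fin d → ℤ) → (Fin d → ℤ) := fun n => Function.update (Function.update n i 0) j 0
    have himg : (s.image F).card ≤ (2 * P + 1) ^ (d - 2) := by
      refine (Finset.card_le_card ?_).trans (card_box_fiber_le hij 0 0)
      intro m hm
      obtain ⟨n, hn, rfl⟩ := Finset.mem_image.1 hm
      have hn' := mem_box.1 (Finset.mem_filter.1 hn).1
      refine Finset.mem_filter.2 ⟨mem_box.2 fun l => ?_, ?_, ?_⟩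
      · by_cases h1 : l = j
        · subst h1; simp [F]
        by_cases h2 : l = i
        · subst h2; simp [F, h1]
        · simpa [F, h1, h2] using hn' l
      · simp [F, hij]
      · simp [F]
    refine (Finset.card_le_mul_card_image s (2 * P / a.natAbs + 1) ?_).trans
      (Nat.mul_le_mul_left _ himg)
    intro m _
    -- two points of a fibre that agree at `i` agree at `j`
    have hsum : ∀ x ∈ s.filter (fun n => F n = m), ∀ y ∈ s.filter (fun n => F n = m),
        (∀ l, l ≠ i → l ≠ j → x l = y l) ∧ (x i - y i) * k i = -((x j - y j) * k j) := by
      intro x hx y hy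
      obtain ⟨hx1, hx2⟩ := Finset.mem_filter.1 hx
      obtain ⟨hy1, hy2⟩ := Finset.mem_filter.1 hy
      have hoff : ∀ l, l ≠ i → l ≠ j → x l = y l := by
        intro l h1 h2
        have := congrFun (hx2.trans hy2.symm) l
        simpa [F, h1, h2] using this
      refine ⟨hoff, ?_⟩
      have e : ∑ l, (x l - y l) * k l = 0 := by
        have := (Finset.mem_filter.1 hx1).2.trans (Finset.mem_filter.1 hy1).2.symm
        simp only [sub_mul, Finset.sum_sub_distrib]
        linarith
      rw [← Finset.add_sum_erase _ _ (Finset.mem_univ i),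
        ← Finset.add_sum_erase _ _ (Finset.mem_erase.2 ⟨hij.symm, Finset.mem_univ j⟩),
        Finset.sum_eq_zero] at e
      · linarith
      · intro l hl
        simp only [Finset.mem_erase] at hl
        rw [hoff l hl.2.1 hl.1]; ring
    have hinj : Set.InjOn (fun n : Fin d → ℤ => n i) (s.filter (fun n => F n = m)) := by
      intro x hx y hy hxy
      obtain ⟨hoff, e⟩ := hsum x hx y hy
      simp only at hxy
      have hj' : x j = y j := by
        rw [hxy, sub_self, zero_mul, zero_eq_neg, mul_eq_zero] at e
        rcases e with e | e
        · linarith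
        · exact absurd e hj
      funext l
      by_cases h1 : l = i
      · rw [h1, hxy]
      by_cases h2 : l = j
      · rw [h2, hj']
      · exact hoff l h1 h2
    rw [← Finset.card_image_of_injOn hinj]
    refine card_le_of_dvd_sub ha0 ?_ ?_
    · intro x hx
      obtain ⟨n, hn, rfl⟩ := Finset.mem_image.1 hx
      have := mem_box.1 (Finset.mem_filter.1 (Finset.mem_filter.1 hn).1).1 i
      simpa [abs_le] using this
    · intro x hx y hy
      obtain ⟨n, hn, rfl⟩ := Finset.mem_image.1 hx
      obtain ⟨n', hn', rfl⟩ := Finset.mem_image.1 hy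
      obtain ⟨-, e⟩ := hsum n hn n' hn'
      rw [Int.natAbs_dvd]
      refine IsCoprime.dvd_of_dvd_mul_right (Int.isCoprime_iff_gcd_eq_one.2 hab) ⟨-(n j - n' j), ?_⟩
      have hg' : (g : ℤ) ≠ 0 := by exact_mod_cast hg0.ne'
      apply mul_right_cancel₀ hg'
      rw [hb, ha] at e
      linear_combination e
  have hP' : a.natAbs * g ≤ 2 * P := by
    rw [← hga]; rw [Int.abs_eq_natAbs] at hP; exact_mod_cast hP
  have habs : |(k j : ℝ)| = a.natAbs * g := by
    rw [← Int.cast_abs, Int.abs_eq_natAbs, hga, Int.cast_natCast, Nat.cast_mul]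
  have ha0' : (0 : ℝ) < a.natAbs := by exact_mod_cast ha0
  have hg0' : (0 : ℝ) < g := by exact_mod_cast hg0
  have hle : (a.natAbs : ℝ) ≤ 2 * P := by
    have : a.natAbs ≤ 2 * P := le_trans (Nat.le_mul_of_pos_right _ hg0) hP'
    exact_mod_cast this
  have hdiv : ((2 * P / a.natAbs : ℕ) : ℝ) ≤ 2 * P / a.natAbs := by
    have := Nat.cast_div_le (α := ℝ) (m := 2 * P) (n := a.natAbs)
    simpa using this
  calc (((box d P).filter fun n => 2 * ∑ l, n l * k l = c).card : ℝ)
      ≤ (((2 * P / a.natAbs + 1) * (2 * P + 1) ^ (d - 2) : ℕ) : ℝ) := by exact_mod_cast key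
    _ = (2 * P + 1) ^ (d - 2) * (((2 * P / a.natAbs : ℕ) : ℝ) + 1) := by push_cast; ring
    _ ≤ (2 * P + 1) ^ (d - 2) * (4 * P * g / |(k j : ℝ)|) := by
        gcongr
        rw [habs]
        have h1 : 4 * (P : ℝ) * g / (a.natAbs * g) = 2 * P / a.natAbs + 2 * P / a.natAbs := by
          field_simp; ring
        rw [h1]
        have : 1 ≤ 2 * (P : ℝ) / a.natAbs := by rwa [le_div_iff₀ ha0', one_mul]
        linarith

theorem sum_gcd_le (m : ℕ) (hm : 0 < m) :
    ∑ b ∈ Finset.Icc (-m : ℤ) m, Int.gcd m b ≤ 3 * m * m.divisors.card := by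
  have h1 : ∀ b : ℤ, Int.gcd m b ≤ ∑ g ∈ m.divisors, if (g : ℤ) ∣ b then g else 0 := by
    intro b
    have hmem : Int.gcd m b ∈ m.divisors := by
      rw [Nat.mem_divisors]
      exact ⟨by simpa using Int.gcd_dvd_natAbs_left (a := (m : ℤ)) (b := b), hm.ne'⟩
    have := Finset.single_le_sum (f := fun g : ℕ => if (g : ℤ) ∣ b then g else 0)
      (fun _ _ => Nat.zero_le _) hmem
    simpa [Int.gcd_dvd_right] using this
  calc ∑ b ∈ Finset.Icc (-m : ℤ) m, Int.gcd m b
      ≤ ∑ b ∈ Finset.Icc (-m : ℤ) m, ∑ g ∈ m.divisors, if (g : ℤ) ∣ b then g else 0 :=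
        Finset.sum_le_sum fun b _ => h1 b
    _ = ∑ g ∈ m.divisors, ∑ b ∈ Finset.Icc (-m : ℤ) m, if (g : ℤ) ∣ b then g else 0 :=
        Finset.sum_comm
    _ ≤ ∑ g ∈ m.divisors, 3 * m := by
        refine Finset.sum_le_sum fun g hg => ?_
        have hgm := Nat.dvd_of_mem_divisors hg
        have hg0 := Nat.pos_of_mem_divisors hg
        rw [← Finset.sum_filter, Finset.sum_const, smul_eq_mul]
        have := card_le_of_dvd_sub hg0 (P := m)
          (s := (Finset.Icc (-m : ℤ) m).filter fun b => (g : ℤ) ∣ b) (Finset.filter_subset _ _)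
          (fun x hx y hy => dvd_sub (Finset.mem_filter.1 hx).2 (Finset.mem_filter.1 hy).2)
        refine (Nat.mul_le_mul_right g this).trans ?_
        have e1 : 2 * m / g * g ≤ 2 * m := Nat.div_mul_le_self _ _
        have e2 := Nat.le_of_dvd hm hgm
        rw [add_mul]; omega
    _ = 3 * m * m.divisors.card := by simp [mul_comm]

/-- A null sequence has partial sums `o(M)`. -/
theorem sum_le_of_tendsto_zero {u : ℕ → ℝ} (hu : Tendsto u atTop (𝓝 0)) {η : ℝ} (hη : 0 < η) :
    ∃ D : ℝ, 0 ≤ D ∧ ∀ M : ℕ, ∑ h ∈ Finset.Icc 1 M, u h ≤ η * M + D := by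
  obtain ⟨H, hH⟩ := eventually_atTop.1 (hu.eventually (ge_mem_nhds hη))
  refine ⟨∑ h ∈ Finset.range H, |u h|, Finset.sum_nonneg fun _ _ => abs_nonneg _, fun M => ?_⟩
  calc ∑ h ∈ Finset.Icc 1 M, u h
      ≤ ∑ h ∈ Finset.Icc 1 M, (η + if h < H then |u h| else 0) := by
        refine Finset.sum_le_sum fun h _ => ?_
        split_ifs with hh
        · linarith [le_abs_self (u h)]
        · linarith [hH h (not_lt.1 hh)]
    _ = η * M + ∑ h ∈ (Finset.Icc 1 M).filter (· < H), |u h| := by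
        rw [Finset.sum_add_distrib, Finset.sum_filter]; simp [mul_comm]
    _ ≤ η * M + ∑ h ∈ Finset.range H, |u h| := by
        gcongr
        intro h hh
        simpa using (Finset.mem_filter.1 hh).2

/-- The weighted divisor function `m ↦ m ^ (-δ) τ(m)` has mean zero, for every `δ > 0`: split
`m = g h`, and use that `h ^ (-δ)` is a null sequence and that `∑ g ^ (-1 - δ)` converges. -/
theorem sum_rpow_mul_card_divisors_le {δ : ℝ} (hδ : 0 < δ) {η : ℝ} (hη : 0 < η) :
    ∃ D : ℝ, 0 ≤ D ∧ ∀ M : ℕ,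
      ∑ m ∈ Finset.Icc 1 M, (m : ℝ) ^ (-δ) * m.divisors.card ≤ η * M + D := by
  have hu : Tendsto (fun h : ℕ => (h : ℝ) ^ (-δ)) atTop (𝓝 0) :=
    (tendsto_rpow_neg_atTop hδ).comp tendsto_natCast_atTop_atTop
  have hs : Summable fun g : ℕ => (g : ℝ) ^ (-(1 + δ)) := by
    rw [Real.summable_nat_rpow]; linarith
  set Z := ∑' g : ℕ, (g : ℝ) ^ (-(1 + δ))
  have hZ : 0 ≤ Z := tsum_nonneg fun g => by positivity
  obtain ⟨D, hD0, hD⟩ := sum_le_of_tendsto_zero hu (η := η / (2 * (Z + 1))) (by positivity)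
  obtain ⟨E, hE0, hE⟩ := sum_le_of_tendsto_zero hu (η := η / (2 * (D + 1))) (by positivity)
  refine ⟨D * E, by positivity, fun M => ?_⟩
  have h1 : ∑ m ∈ Finset.Icc 1 M, (m : ℝ) ^ (-δ) * m.divisors.card ≤
      ∑ g ∈ Finset.Icc 1 M, (g : ℝ) ^ (-δ) * ∑ h ∈ Finset.Icc 1 (M / g), (h : ℝ) ^ (-δ) := by
    simp only [Finset.mul_sum]
    have : ∀ m ∈ Finset.Icc 1 M, (m : ℝ) ^ (-δ) * m.divisors.card =
        ∑ p ∈ m.divisorsAntidiagonal, (p.1 : ℝ) ^ (-δ) * (p.2 : ℝ) ^ (-δ) := by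
      intro m _
      rw [Finset.sum_congr rfl (g := fun _ => (m : ℝ) ^ (-δ))]
      · rw [Finset.sum_const, ← Nat.map_div_right_divisors, Finset.card_map, nsmul_eq_mul, mul_comm]
      · intro p hp
        rw [← (Nat.mem_divisorsAntidiagonal.1 hp).1, Nat.cast_mul,
          Real.mul_rpow (Nat.cast_nonneg _) (Nat.cast_nonneg _)]
    rw [Finset.sum_congr rfl this, Finset.sum_sigma', Finset.sum_sigma']
    refine (Finset.sum_nbij' (fun x => ⟨x.2.1, x.2.2⟩) (fun x => ⟨x.1 * x.2, (x.1, x.2)⟩)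
      ?_ ?_ ?_ ?_ ?_).le
    · rintro ⟨m, g, h⟩ hx
      simp only [Finset.mem_sigma, Finset.mem_Icc, Nat.mem_divisorsAntidiagonal] at hx ⊢
      obtain ⟨⟨h1, h2⟩, rfl, h3⟩ := hx
      have hg := Nat.pos_of_ne_zero (left_ne_zero_of_mul h3)
      have hh := Nat.pos_of_ne_zero (right_ne_zero_of_mul h3)
      exact ⟨⟨hg, (Nat.le_mul_of_pos_right _ hh).trans h2⟩, hh,
        (Nat.le_div_iff_mul_le hg).2 (by rwa [mul_comm])⟩
    · rintro ⟨g, h⟩ hx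
      simp only [Finset.mem_sigma, Finset.mem_Icc, Nat.mem_divisorsAntidiagonal] at hx ⊢
      obtain ⟨⟨h1, h2⟩, h3, h4⟩ := hx
      rw [Nat.le_div_iff_mul_le h1, mul_comm] at h4
      exact ⟨⟨Nat.mul_pos h1 h3, h4⟩, trivial, (Nat.mul_pos h1 h3).ne'⟩
    · rintro ⟨m, g, h⟩ hx
      simp only [Finset.mem_sigma, Nat.mem_divisorsAntidiagonal] at hx
      obtain ⟨-, rfl, -⟩ := hx
      rfl
    · rintro ⟨g, h⟩ _
      rfl
    · rintro ⟨m, g, h⟩ _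
      rfl
  have hg : ∀ g ∈ Finset.Icc 1 M, (g : ℝ) ^ (-δ) * ∑ h ∈ Finset.Icc 1 (M / g), (h : ℝ) ^ (-δ) ≤
      η / (2 * (Z + 1)) * M * (g : ℝ) ^ (-(1 + δ)) + D * (g : ℝ) ^ (-δ) := by
    intro g hg
    have hg0 : (0 : ℝ) < g := by exact_mod_cast (Finset.mem_Icc.1 hg).1
    have hdiv : ((M / g : ℕ) : ℝ) ≤ M / g := Nat.cast_div_le
    calc (g : ℝ) ^ (-δ) * ∑ h ∈ Finset.Icc 1 (M / g), (h : ℝ) ^ (-δ)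
        ≤ (g : ℝ) ^ (-δ) * (η / (2 * (Z + 1)) * (M / g) + D) := by
          gcongr
          exact (hD _).trans (by gcongr)
      _ = _ := by
          rw [show -(1 + δ) = -δ - 1 by ring, Real.rpow_sub_one hg0.ne']
          ring
  calc _ ≤ _ := h1
    _ ≤ _ := Finset.sum_le_sum hg
    _ = η / (2 * (Z + 1)) * M * ∑ g ∈ Finset.Icc 1 M, (g : ℝ) ^ (-(1 + δ))
        + D * ∑ g ∈ Finset.Icc 1 M, (g : ℝ) ^ (-δ) := by
        rw [Finset.sum_add_distrib, Finset.mul_sum, Finset.mul_sum]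
    _ ≤ η / (2 * (Z + 1)) * M * Z + D * (η / (2 * (D + 1)) * M + E) := by
        gcongr
        · exact hs.sum_le_tsum _ fun g _ => by positivity
        · exact hE M
    _ = η / 2 * M * (Z / (Z + 1)) + η / 2 * M * (D / (D + 1)) + D * E := by
        field_simp
        ring
    _ ≤ η / 2 * M * 1 + η / 2 * M * 1 + D * E := by
        gcongr
        · rw [div_le_one (by positivity)]; linarith
        · rw [div_le_one (by positivity)]; linarith
    _ = η * M + D * E := by ring

/-! ### Pairs of lattice points of equal norm -/

/-- The contribution of the differences `k` whose largest coordinate is the `j`-th one. -/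
theorem sum_dominant_coordinate_le {d : ℕ} (hd : 2 ≤ d) {α A : ℝ} (hA : 0 ≤ A)
    {v : (Fin d → ℤ) → ℝ}
    (hv : ∀ k j, k j ≠ 0 → (∀ i, |k i| ≤ |k j|) → v k ≤ A * |(k j : ℝ)| ^ (-α))
    {i j : Fin d} (hij : i ≠ j) (P : ℕ) :
    ∑ k ∈ (box d (2 * P)).filter fun k => k j ≠ 0 ∧ ∀ l, |k l| ≤ |k j|,
        v k * ((box d P).filter fun n => 2 * ∑ l, n l * k l = ∑ l, k l ^ 2).card ≤
      24 * A * 9 ^ (d - 2) * P ^ (d - 1) *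
        ∑ m ∈ Finset.Icc 1 (2 * P), (m : ℝ) ^ (-(α - (d - 2))) * m.divisors.card := by
  classical
  set s := (box d (2 * P)).filter fun k => k j ≠ 0 ∧ ∀ l, |k l| ≤ |k j| with hs
  have hmem : ∀ k ∈ s, (∀ l, |k l| ≤ 2 * P) ∧ k j ≠ 0 ∧ ∀ l, |k l| ≤ |k j| := by
    intro k hk
    obtain ⟨h1, h2⟩ := Finset.mem_filter.1 hk
    exact ⟨by simpa using mem_box.1 h1, h2⟩
  set c : ℝ := A * ((3 * P) ^ (d - 2) * (4 * P)) with hc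
  have hc0 : 0 ≤ c := by positivity
  have hmaps : ∀ k ∈ s, (k j).natAbs ∈ Finset.Icc 1 (2 * P) := by
    intro k hk
    obtain ⟨h1, h2, -⟩ := hmem k hk
    have := h1 j
    rw [Int.abs_eq_natAbs] at this
    rw [Finset.mem_Icc]
    omega
  have hterm : ∀ k ∈ s,
      v k * ((box d P).filter fun n => 2 * ∑ l, n l * k l = ∑ l, k l ^ 2).card ≤
        c * ((k j).natAbs : ℝ) ^ (-α - 1) * Int.gcd (k j).natAbs (k i) := by
    intro k hk
    obtain ⟨h1, h2, h3⟩ := hmem k hk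
    have hP : (1 : ℝ) ≤ P := by
      have := Finset.mem_Icc.1 (hmaps k hk)
      have : 1 ≤ P := by omega
      exact_mod_cast this
    have habs : |(k j : ℝ)| = (k j).natAbs := by
      rw [← Int.cast_abs, Int.abs_eq_natAbs, Int.cast_natCast]
    have hpos : (0 : ℝ) < (k j).natAbs := by exact_mod_cast Int.natAbs_pos.2 h2
    calc _ ≤ A * |(k j : ℝ)| ^ (-α) *
          ((2 * P + 1) ^ (d - 2) * (4 * P * (k j).gcd (k i) / |(k j : ℝ)|)) := by
          gcongr
          · exact hv k j h2 h3
          · exact card_hyperplane_le hij k h2 (h1 j) _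
      _ ≤ A * |(k j : ℝ)| ^ (-α) *
          ((3 * P) ^ (d - 2) * (4 * P * (k j).gcd (k i) / |(k j : ℝ)|)) := by
          gcongr; linarith
      _ = _ := by
          rw [habs, Real.rpow_sub_one hpos.ne', hc, Int.gcd, Int.gcd, Int.natAbs_natCast]
          ring
  have hfib : ∀ m ∈ Finset.Icc 1 (2 * P),
      ∑ k ∈ s.filter (fun k => (k j).natAbs = m),
        c * ((k j).natAbs : ℝ) ^ (-α - 1) * (Int.gcd (k j).natAbs (k i) : ℝ) ≤
      6 * c * 3 ^ (d - 2) * ((m : ℝ) ^ (-(α - (d - 2))) * m.divisors.card) := by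
    intro m hm
    have hm1 : 1 ≤ m := (Finset.mem_Icc.1 hm).1
    have hm0 : (0 : ℝ) < m := by exact_mod_cast hm1
    have hm1' : (1 : ℝ) ≤ m := by exact_mod_cast hm1
    have hmaps' : ∀ k ∈ s.filter (fun k => (k j).natAbs = m), k i ∈ Finset.Icc (-m : ℤ) m := by
      intro k hk
      obtain ⟨hk1, hk2⟩ := Finset.mem_filter.1 hk
      have := (hmem k hk1).2.2 i
      rw [Int.abs_eq_natAbs, Int.abs_eq_natAbs] at this
      rw [Finset.mem_Icc]
      omega
    have hcard : ∀ b : ℤ, ((s.filter (fun k => (k j).natAbs = m)).filter fun k => k i = b).card ≤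
        2 * (2 * m + 1) ^ (d - 2) := by
      intro b
      rw [two_mul ((2 * m + 1) ^ (d - 2))]
      refine (Finset.card_le_card ?_).trans ((Finset.card_union_le _ _).trans
        (add_le_add (card_box_fiber_le (P := m) hij b m) (card_box_fiber_le (P := m) hij b (-m))))
      intro k hk
      simp only [Finset.mem_filter] at hk
      obtain ⟨⟨hk1, hk2⟩, hk3⟩ := hk
      have h3 := (hmem k hk1).2.2
      have hb : k ∈ box d m := mem_box.2 fun l => by
        have := h3 l
        rw [Int.abs_eq_natAbs, Int.abs_eq_natAbs] at this
        rw [Int.abs_eq_natAbs]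
        omega
      rw [Finset.mem_union, Finset.mem_filter, Finset.mem_filter]
      rcases Int.natAbs_eq (k j) with h | h
      · left; exact ⟨hb, hk3, by omega⟩
      · right; exact ⟨hb, hk3, by omega⟩
    rw [← Finset.sum_fiberwise_of_maps_to hmaps']
    calc _ ≤ ∑ b ∈ Finset.Icc (-m : ℤ) m,
          (2 * (3 * m) ^ (d - 2)) * (c * (m : ℝ) ^ (-α - 1) * (Int.gcd m b : ℝ)) := by
          refine Finset.sum_le_sum fun b _ => ?_
          rw [Finset.sum_congr rfl (g := fun _ => c * (m : ℝ) ^ (-α - 1) * (Int.gcd m b : ℝ))]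
          · rw [Finset.sum_const, nsmul_eq_mul]
            gcongr
            calc ((((s.filter (fun k => (k j).natAbs = m)).filter fun k => k i = b).card : ℕ) : ℝ)
                ≤ ((2 * (2 * m + 1) ^ (d - 2) : ℕ) : ℝ) := by exact_mod_cast hcard b
              _ = 2 * (2 * (m : ℝ) + 1) ^ (d - 2) := by push_cast; ring
              _ ≤ _ := by gcongr; linarith
          · intro k hk
            simp only [Finset.mem_filter] at hk
            rw [hk.1.2, hk.2]
      _ = (2 * (3 * m) ^ (d - 2)) * (c * (m : ℝ) ^ (-α - 1)) *
          ((∑ b ∈ Finset.Icc (-m : ℤ) m, Int.gcd m b : ℕ) : ℝ) := by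
          push_cast
          rw [Finset.mul_sum]
          refine Finset.sum_congr rfl fun b _ => ?_
          ring
      _ ≤ (2 * (3 * m) ^ (d - 2)) * (c * (m : ℝ) ^ (-α - 1)) *
          ((3 * m * m.divisors.card : ℕ) : ℝ) := by
          gcongr
          exact sum_gcd_le m hm1
      _ = _ := by
          have e : (m : ℝ) ^ (-(α - (d - 2))) = (m : ℝ) ^ (d - 2) * (m : ℝ) ^ (-α - 1) * m := by
            rw [show -(α - ((d : ℝ) - 2)) = ((d - 2 : ℕ) : ℝ) + (-α - 1) + 1 by
              push_cast [hd]; ring, Real.rpow_add_one hm0.ne', Real.rpow_add hm0, Real.rpow_natCast]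
          rw [e]
          push_cast
          ring
  calc _ ≤ ∑ k ∈ s, c * ((k j).natAbs : ℝ) ^ (-α - 1) * (Int.gcd (k j).natAbs (k i) : ℝ) :=
        Finset.sum_le_sum hterm
    _ ≤ ∑ m ∈ Finset.Icc 1 (2 * P),
        6 * c * 3 ^ (d - 2) * ((m : ℝ) ^ (-(α - (d - 2))) * m.divisors.card) := by
        rw [← Finset.sum_fiberwise_of_maps_to hmaps]
        exact Finset.sum_le_sum hfib
    _ = _ := by
        rw [← Finset.mul_sum, hc, show d - 1 = (d - 2) + 1 by omega, pow_succ, mul_pow,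
          show (9 : ℝ) = 3 * 3 by norm_num, mul_pow]
        ring

/-- Lattice points on a sphere have few close differences: a weight `v` decaying like
`|k| ^ (-α)` with `α > d - 2` has sum `o(P ^ d)` over the pairs of distinct points of equal norm
in a cube of side `2 P`. A pair with difference `k` satisfies `2 n · k = |k|²`, so that the pairs
are counted by the points of hyperplane sections of the cube. -/
theorem sum_equal_norm_pairs_le {d : ℕ} (hd : 2 ≤ d) {α A : ℝ} (hα : (d : ℝ) - 2 < α)
    (hA : 0 ≤ A) {v : (Fin d → ℤ) → ℝ} (hv0 : ∀ k, 0 ≤ v k)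
    (hv : ∀ k j, k j ≠ 0 → (∀ i, |k i| ≤ |k j|) → v k ≤ A * |(k j : ℝ)| ^ (-α))
    {η : ℝ} (hη : 0 < η) :
    ∃ D : ℝ, 0 ≤ D ∧ ∀ P : ℕ, ∑ n ∈ box d P, ∑ m ∈ box d P,
      (if n ≠ m ∧ ∑ i, n i ^ 2 = ∑ i, m i ^ 2 then v (n - m) else 0) ≤ η * P ^ d + D := by
  classical
  have : NeZero d := ⟨by omega⟩
  set K : ℝ := d * (24 * A * 9 ^ (d - 2)) with hK
  have hK0 : 0 ≤ K := by positivity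
  obtain ⟨D, hD0, hD⟩ := sum_rpow_mul_card_divisors_le (δ := α - (d - 2)) (by linarith)
    (η := η / (4 * (K + 1))) (by positivity)
  set B : ℝ := 2 * (K + 1) * D / η with hB
  have hB0 : 0 ≤ B := by positivity
  refine ⟨K * B ^ (d - 1) * D, by positivity, fun P => ?_⟩
  have hcoord : ∀ j : Fin d, ∃ i, i ≠ j := fun j =>
    have : Nontrivial (Fin d) := Fin.nontrivial_iff_two_le.2 hd
    exists_ne j
  choose σ hσ using hcoord
  set c : (Fin d → ℤ) → ℝ := fun k =>
    ((box d P).filter fun n => 2 * ∑ l, n l * k l = ∑ l, k l ^ 2).card with hcdef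
  -- the pairs with a given difference
  have h1 : ∑ n ∈ box d P, ∑ m ∈ box d P,
      (if n ≠ m ∧ ∑ i, n i ^ 2 = ∑ i, m i ^ 2 then v (n - m) else 0) ≤
      ∑ k ∈ (box d (2 * P)).filter (· ≠ 0), v k * c k := by
    have hin : ∀ n ∈ box d P, ∑ m ∈ box d P,
        (if n ≠ m ∧ ∑ i, n i ^ 2 = ∑ i, m i ^ 2 then v (n - m) else 0) ≤
        ∑ k ∈ (box d (2 * P)).filter (· ≠ 0),
          if 2 * ∑ l, n l * k l = ∑ l, k l ^ 2 then v k else 0 := by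
      intro n hn
      rw [← Finset.sum_filter]
      have hinj : Set.InjOn (fun m => n - m)
          ((box d P).filter fun m => n ≠ m ∧ ∑ i, n i ^ 2 = ∑ i, m i ^ 2) :=
        fun _ _ _ _ h => sub_right_injective h
      rw [← Finset.sum_image (f := v) hinj, ← Finset.sum_filter]
      refine Finset.sum_le_sum_of_subset_of_nonneg ?_ fun k _ _ => hv0 k
      intro k hk
      obtain ⟨m, hm, rfl⟩ := Finset.mem_image.1 hk
      obtain ⟨hm1, hm2, hm3⟩ := Finset.mem_filter.1 hm
      refine Finset.mem_filter.2 ⟨Finset.mem_filter.2 ⟨mem_box.2 fun i => ?_, ?_⟩, ?_⟩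
      · have a1 := mem_box.1 hn i
        have a2 := mem_box.1 hm1 i
        have := abs_sub (n i) (m i)
        push_cast
        simp only [Pi.sub_apply]
        linarith
      · exact sub_ne_zero.2 hm2
      · have e : 2 * ∑ l, n l * (n - m) l - ∑ l, (n - m) l ^ 2 =
            ∑ l, n l ^ 2 - ∑ l, m l ^ 2 := by
          rw [Finset.mul_sum, ← Finset.sum_sub_distrib, ← Finset.sum_sub_distrib]
          refine Finset.sum_congr rfl fun l _ => ?_
          simp only [Pi.sub_apply]
          ring
        rw [hm3, sub_self] at e
        linarith
    refine (Finset.sum_le_sum hin).trans_eq ?_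
    rw [Finset.sum_comm]
    refine Finset.sum_congr rfl fun k _ => ?_
    rw [← Finset.sum_filter, Finset.sum_const, nsmul_eq_mul, mul_comm]
  -- sort the differences by their largest coordinate
  have h2 : ∑ k ∈ (box d (2 * P)).filter (· ≠ 0), v k * c k ≤
      ∑ j : Fin d, ∑ k ∈ (box d (2 * P)).filter fun k => k j ≠ 0 ∧ ∀ l, |k l| ≤ |k j|,
        v k * c k := by
    have hnn : ∀ k, 0 ≤ v k * c k := fun k => mul_nonneg (hv0 k) (Nat.cast_nonneg _)
    simp_rw [Finset.sum_filter]
    rw [Finset.sum_comm]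
    refine Finset.sum_le_sum fun k _ => ?_
    split_ifs with hk
    · obtain ⟨j, -, hj⟩ := Finset.exists_max_image Finset.univ (fun l => |k l|)
        Finset.univ_nonempty
      have hj0 : k j ≠ 0 := by
        intro h
        apply hk
        funext l
        have := hj l (Finset.mem_univ l)
        simpa [h] using this
      have := Finset.single_le_sum
        (f := fun j => if k j ≠ 0 ∧ ∀ l, |k l| ≤ |k j| then v k * c k else 0)
        (fun j _ => by split_ifs <;> simp [hnn]) (Finset.mem_univ j)
      refine le_trans ?_ this
      rw [if_pos ⟨hj0, fun l => hj l (Finset.mem_univ l)⟩]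
    · exact Finset.sum_nonneg fun j _ => by split_ifs <;> simp [hnn]
  have h3 : ∑ j : Fin d, ∑ k ∈ (box d (2 * P)).filter fun k => k j ≠ 0 ∧ ∀ l, |k l| ≤ |k j|,
        v k * c k ≤ K * P ^ (d - 1) * (η / (4 * (K + 1)) * ((2 * P : ℕ) : ℝ) + D) := by
    calc _ ≤ ∑ j : Fin d, 24 * A * 9 ^ (d - 2) * P ^ (d - 1) *
          (η / (4 * (K + 1)) * ((2 * P : ℕ) : ℝ) + D) := by
          refine Finset.sum_le_sum fun j _ => ?_
          refine (sum_dominant_coordinate_le hd hA hv (hσ j) P).trans ?_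
          gcongr
          exact hD _
      _ = _ := by
          rw [Finset.sum_const, Finset.card_univ, Fintype.card_fin, nsmul_eq_mul, hK]; ring
  have hpow : (P : ℝ) ^ d = P ^ (d - 1) * P := by
    rw [← pow_succ, Nat.sub_add_cancel (by omega)]
  -- the lower order term is absorbed by the main one once `P ≥ B`
  have h4 : K * P ^ (d - 1) * D ≤ η / 2 * P ^ d + K * B ^ (d - 1) * D := by
    rcases le_total (P : ℝ) B with hPB | hPB
    · have : K * (P : ℝ) ^ (d - 1) * D ≤ K * B ^ (d - 1) * D := by gcongr
      have : 0 ≤ η / 2 * (P : ℝ) ^ d := by positivity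
      linarith
    · have hKD : K * D ≤ η / 2 * P := by
        have : η / 2 * B = (K + 1) * D := by rw [hB]; field_simp
        nlinarith
      have : K * (P : ℝ) ^ (d - 1) * D ≤ η / 2 * P ^ d := by
        rw [hpow]
        calc K * (P : ℝ) ^ (d - 1) * D = P ^ (d - 1) * (K * D) := by ring
          _ ≤ P ^ (d - 1) * (η / 2 * P) := by gcongr
          _ = _ := by ring
      have : 0 ≤ K * B ^ (d - 1) * D := by positivity
      linarith
  have h5 : K * P ^ (d - 1) * (η / (4 * (K + 1)) * ((2 * P : ℕ) : ℝ)) ≤ η / 2 * P ^ d := by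
    calc K * P ^ (d - 1) * (η / (4 * (K + 1)) * ((2 * P : ℕ) : ℝ))
        = η / 2 * P ^ d * (K / (K + 1)) := by rw [hpow]; push_cast; field_simp; ring
      _ ≤ η / 2 * P ^ d * 1 := by
          gcongr
          rw [div_le_one (by positivity)]; linarith
      _ = _ := mul_one _
  calc _ ≤ _ := h1.trans (h2.trans h3)
    _ = K * P ^ (d - 1) * (η / (4 * (K + 1)) * ((2 * P : ℕ) : ℝ)) + K * P ^ (d - 1) * D := by ring
    _ ≤ η * P ^ d + K * B ^ (d - 1) * D := by linarith

/-! ### Sequences with vanishing Cesàro means -/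

/-- A null sequence has a positive antitone majorant that is a null sequence. -/
theorem exists_antitone_majorant {a : ℕ → ℝ} (ha : Tendsto a atTop (𝓝 0)) :
    ∃ s : ℕ → ℝ, Antitone s ∧ (∀ N, 0 < s N) ∧ (∀ N, a N ≤ s N) ∧ Tendsto s atTop (𝓝 0) := by
  have hbdd : ∀ N, BddAbove (Set.range fun k => |a (N + k)|) := by
    intro N
    obtain ⟨b, hb⟩ := ha.abs.bddAbove_range
    exact ⟨b, by rintro _ ⟨k, rfl⟩; exact hb ⟨N + k, rfl⟩⟩
  have hpos : ∀ N : ℕ, (0 : ℝ) < 1 / (N + 1) := fun N => Nat.one_div_pos_of_nat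
  have hle : ∀ N, |a N| ≤ ⨆ k, |a (N + k)| := fun N => le_ciSup (hbdd N) 0
  refine ⟨fun N => (⨆ k, |a (N + k)|) + 1 / (N + 1), ?_, ?_, ?_, ?_⟩
  · intro M N hMN
    refine add_le_add ?_ (Nat.one_div_le_one_div hMN)
    refine ciSup_le fun k => ?_
    have := le_ciSup (hbdd M) (N - M + k)
    rwa [← add_assoc, Nat.add_sub_cancel' hMN] at this
  · intro N
    have := (abs_nonneg _).trans (hle N)
    have := hpos N
    linarith
  · intro N
    have := (le_abs_self _).trans (hle N)
    have := hpos N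
    linarith
  · rw [← add_zero (0 : ℝ)]
    refine Tendsto.add ?_ tendsto_one_div_add_atTop_nhds_zero_nat
    rw [Metric.tendsto_atTop]
    intro ε hε
    obtain ⟨N₀, hN₀⟩ := Metric.tendsto_atTop.1 ha (ε / 2) (by positivity)
    refine ⟨N₀, fun N hN => ?_⟩
    have h1 : (⨆ k, |a (N + k)|) ≤ ε / 2 := ciSup_le fun k => by
      have := hN₀ (N + k) (by omega)
      rw [Real.dist_eq, sub_zero] at this
      exact this.le
    have h2 := (abs_nonneg _).trans (hle N)
    rw [Real.dist_eq, sub_zero, abs_of_nonneg h2]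
    linarith

/-- The Koopman–von Neumann lemma: a nonnegative sequence with Cesàro means tending to `0` tends to
`0` along a set of density one. -/
theorem exists_densityOne_of_cesaro {y : ℕ → ℝ} (hy : ∀ j, 0 ≤ y j)
    (h : Tendsto (fun N : ℕ => (∑ j ∈ Finset.range N, y j) / N) atTop (𝓝 0)) :
    ∃ S : Set ℕ, HasDensityOne S ∧ Tendsto y (atTop ⊓ 𝓟 S) (𝓝 0) := by
  classical
  obtain ⟨s, hanti, hpos, hle, hs⟩ := exists_antitone_majorant h
  have hsq : Tendsto (fun N => √(s N)) atTop (𝓝 0) := by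
    have := (Real.continuous_sqrt.tendsto 0).comp hs
    rwa [Real.sqrt_zero] at this
  refine ⟨{j | y j ≤ √(s j)}, ?_, ?_⟩
  · have hcount : ∀ N : ℕ, 1 ≤ N →
        (({j | y j ≤ √(s j)} ∩ Set.Iio N).ncard : ℝ) / N =
          1 - ((Finset.range N).filter fun j => ¬ y j ≤ √(s j)).card / N := by
      intro N hN
      have hN' : (N : ℝ) ≠ 0 := by positivity
      have e1 : ({j | y j ≤ √(s j)} ∩ Set.Iio N) =
          ((Finset.range N).filter fun j => y j ≤ √(s j) : Finset ℕ) := by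
        ext j; simp [and_comm]
      have e2 := Finset.card_filter_add_card_filter_not (s := Finset.range N)
        (fun j => y j ≤ √(s j))
      rw [Finset.card_range] at e2
      have e3 : (((Finset.range N).filter fun j => y j ≤ √(s j)).card : ℝ) +
          ((Finset.range N).filter fun j => ¬ y j ≤ √(s j)).card = N := by exact_mod_cast e2
      rw [e1, Set.ncard_coe_finset, eq_sub_iff_add_eq, ← add_div, e3, div_self hN']
    -- Chebyshev's inequality: the threshold only decreases, so that it is at least `√(s N)`
    have hbad : ∀ N : ℕ, 1 ≤ N →
        (((Finset.range N).filter fun j => ¬ y j ≤ √(s j)).card : ℝ) / N ≤ √(s N) := by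
      intro N hN
      have hN' : (0 : ℝ) < N := by exact_mod_cast hN
      have hsN : 0 < √(s N) := Real.sqrt_pos.2 (hpos N)
      have h1 : (((Finset.range N).filter fun j => ¬ y j ≤ √(s j)).card : ℝ) * √(s N) ≤
          N * s N := by
        calc _ = ∑ j ∈ (Finset.range N).filter fun j => ¬ y j ≤ √(s j), √(s N) := by simp
          _ ≤ ∑ j ∈ (Finset.range N).filter fun j => ¬ y j ≤ √(s j), y j := by
              refine Finset.sum_le_sum fun j hj => ?_
              obtain ⟨hj1, hj2⟩ := Finset.mem_filter.1 hj
              exact (Real.sqrt_le_sqrt (hanti (Finset.mem_range.1 hj1).le)).trans (not_le.1 hj2).le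
          _ ≤ ∑ j ∈ Finset.range N, y j :=
              Finset.sum_le_sum_of_subset_of_nonneg (Finset.filter_subset _ _) fun j _ _ => hy j
          _ ≤ N * s N := by
              have := hle N
              rwa [div_le_iff₀ hN', mul_comm] at this
      rw [div_le_iff₀ hN', ← mul_le_mul_iff_of_pos_right hsN]
      refine h1.trans_eq ?_
      nth_rewrite 1 [← Real.mul_self_sqrt (hpos N).le]
      ring
    have hbad' : Tendsto (fun N : ℕ =>
        (((Finset.range N).filter fun j => ¬ y j ≤ √(s j)).card : ℝ) / N) atTop (𝓝 0) :=
      squeeze_zero' (Eventually.of_forall fun N => by positivity)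
        (eventually_atTop.2 ⟨1, hbad⟩) hsq
    have := hbad'.const_sub 1
    rw [sub_zero] at this
    exact this.congr' (eventually_atTop.2 ⟨1, fun N hN => (hcount N hN).symm⟩)
  · refine squeeze_zero' (Eventually.of_forall hy) ?_ (hsq.mono_left inf_le_left)
    exact eventually_inf_principal.2 (Eventually.of_forall fun j hj => hj)

/-- The Koopman–von Neumann lemma for countably many sequences at once: apply it to a convergent
weighted sum of the truncated sequences. -/
theorem exists_densityOne_of_forall_cesaro {ι : Type*} [Countable ι] {x : ι → ℕ → ℝ}
    (hx : ∀ i j, 0 ≤ x i j)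
    (h : ∀ i, Tendsto (fun N : ℕ => (∑ j ∈ Finset.range N, x i j) / N) atTop (𝓝 0)) :
    ∃ S : Set ℕ, HasDensityOne S ∧ ∀ i, Tendsto (x i) (atTop ⊓ 𝓟 S) (𝓝 0) := by
  classical
  obtain ⟨_⟩ := nonempty_encodable ι
  obtain ⟨w, hw, c, hc, -⟩ := posSumOfEncodable one_pos ι
  have hmin0 : ∀ i j, 0 ≤ min 1 (x i j) := fun i j => le_min zero_le_one (hx i j)
  have hterm0 : ∀ i j, 0 ≤ w i * min 1 (x i j) := fun i j => mul_nonneg (hw i).le (hmin0 i j)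
  have hterm1 : ∀ i j, w i * min 1 (x i j) ≤ w i := fun i j =>
    mul_le_of_le_one_right (hw i).le (min_le_left _ _)
  have hsum : ∀ j, Summable fun i => w i * min 1 (x i j) := fun j =>
    Summable.of_nonneg_of_le (fun i => hterm0 i j) (fun i => hterm1 i j) hc.summable
  set y : ℕ → ℝ := fun j => ∑' i, w i * min 1 (x i j) with hydef
  have hy : ∀ j, 0 ≤ y j := fun j => tsum_nonneg fun i => hterm0 i j
  have hces : Tendsto (fun N : ℕ => (∑ j ∈ Finset.range N, y j) / N) atTop (𝓝 0) := by
    have e : ∀ N : ℕ, (∑ j ∈ Finset.range N, y j) / N =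
        ∑' i, (∑ j ∈ Finset.range N, w i * min 1 (x i j)) / N := by
      intro N
      rw [tsum_div_const, Summable.tsum_finsetSum fun j _ => hsum j]
    simp_rw [e]
    rw [← tsum_zero (α := ℝ) (β := ι)]
    refine tendsto_tsum_of_dominated_convergence hc.summable (fun i => ?_)
      (Eventually.of_forall fun N i => ?_)
    · have := (h i).const_mul (w i)
      rw [mul_zero] at this
      refine squeeze_zero (fun N => div_nonneg (Finset.sum_nonneg fun j _ => hterm0 i j)
        (Nat.cast_nonneg _)) (fun N => ?_) this
      rw [← mul_div_assoc, Finset.mul_sum]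
      gcongr with j _
      · exact (hw i).le
      · exact min_le_right _ _
    · have h0 : 0 ≤ (∑ j ∈ Finset.range N, w i * min 1 (x i j)) / N :=
        div_nonneg (Finset.sum_nonneg fun j _ => hterm0 i j) (Nat.cast_nonneg _)
      rw [Real.norm_of_nonneg h0]
      refine div_le_of_le_mul₀ (Nat.cast_nonneg _) (hw i).le ?_
      refine (Finset.sum_le_sum fun j _ => hterm1 i j).trans_eq ?_
      simp [mul_comm]
  obtain ⟨S, hS, hyS⟩ := exists_densityOne_of_cesaro hy hces
  refine ⟨S, hS, fun i => ?_⟩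
  have hmin : Tendsto (fun j => min 1 (x i j)) (atTop ⊓ 𝓟 S) (𝓝 0) := by
    have := hyS.const_mul (w i)⁻¹
    rw [mul_zero] at this
    refine squeeze_zero (hmin0 i) (fun j => ?_) this
    rw [← div_eq_inv_mul, le_div_iff₀ (hw i), mul_comm]
    exact (hsum j).le_tsum i fun i' _ => hterm0 i' j
  refine hmin.congr' ?_
  filter_upwards [hmin.eventually (gt_mem_nhds one_pos)] with j hj
  rcases min_lt_iff.1 hj with h1 | h1
  · exact absurd h1 (lt_irrefl _)
  · exact min_eq_right h1.le

/-! ### Trigonometric polynomials on the torus -/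

open ComplexConjugate Submodule

/-- The exponential `x ↦ exp (i n·x)` as a bundled continuous function. -/
noncomputable def expMap {d : ℕ} (n : Fin d → ℤ) : C(Torus d, ℂ) where
  toFun := expMonomial n
  continuous_toFun := by unfold expMonomial; fun_prop

@[simp]
theorem expMap_apply {d : ℕ} (n : Fin d → ℤ) (x : Torus d) : expMap n x = expMonomial n x := rfl

theorem expMonomial_neg {d : ℕ} (n : Fin d → ℤ) (x : Torus d) :
    expMonomial (-n) x = conj (expMonomial n x) := by
  simp [expMonomial, map_prod]

theorem expMonomial_add {d : ℕ} (m n : Fin d → ℤ) (x : Torus d) :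
    expMonomial (m + n) x = expMonomial m x * expMonomial n x := by
  simp [expMonomial, Finset.prod_mul_distrib]

theorem expMonomial_zero {d : ℕ} (x : Torus d) : expMonomial 0 x = 1 := by
  simp [expMonomial]

theorem norm_expMonomial {d : ℕ} (n : Fin d → ℤ) (x : Torus d) : ‖expMonomial n x‖ = 1 := by
  rw [expMonomial, norm_prod]
  exact Finset.prod_eq_one fun i _ => by rw [fourier_apply, Circle.norm_coe]

/-- The star subalgebra of `C(𝕋^d, ℂ)` generated by the exponentials. -/
noncomputable def expSubalgebra (d : ℕ) : StarSubalgebra ℂ C(Torus d, ℂ) where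
  toSubalgebra := Algebra.adjoin ℂ (Set.range expMap)
  star_mem' := by
    change Algebra.adjoin ℂ (Set.range expMap) ≤ star (Algebra.adjoin ℂ (Set.range expMap))
    refine Algebra.adjoin_le ?_
    rintro _ ⟨n, rfl⟩
    refine Algebra.subset_adjoin ⟨-n, ?_⟩
    ext1 x
    simp [expMonomial_neg]

theorem expSubalgebra_toSubmodule (d : ℕ) :
    (expSubalgebra d).toSubalgebra.toSubmodule = span ℂ (Set.range expMap) := by
  apply Algebra.adjoin_eq_span_of_subset
  refine .trans (fun x ↦ Submonoid.closure_induction (fun _ ↦ id) ⟨0, ?_⟩ ?_) subset_span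
  · ext z
    simp [expMonomial_zero]
  · rintro _ _ _ _ ⟨m, rfl⟩ ⟨n, rfl⟩
    refine ⟨m + n, ?_⟩
    ext z
    simp [expMonomial_add]

theorem expSubalgebra_separatesPoints (d : ℕ) :
    (expSubalgebra d).toSubalgebra.SeparatesPoints := by
  intro x y hxy
  obtain ⟨i, hi⟩ := Function.ne_iff.1 hxy
  refine ⟨_, ⟨expMap (Pi.single i 1), Algebra.subset_adjoin ⟨Pi.single i 1, rfl⟩, rfl⟩, ?_⟩
  have key : ∀ z : Torus d, expMonomial (Pi.single i 1) z = fourier 1 (z i) := by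
    intro z
    rw [expMonomial, Finset.prod_eq_single i]
    · simp
    · intro j _ hj
      simp [Pi.single_eq_of_ne hj]
    · simp
  simp only [expMap_apply]
  rw [key, key, fourier_one, fourier_one]
  exact fun h => hi (AddCircle.injective_toCircle Real.two_pi_pos.ne' (Circle.ext h))

/-- Trigonometric polynomials are uniformly dense in the continuous functions on the torus. -/
theorem span_expMap_closure_eq_top (d : ℕ) :
    (span ℂ (Set.range (expMap (d := d)))).topologicalClosure = ⊤ := by
  rw [← expSubalgebra_toSubmodule]
  exact congr_arg (Subalgebra.toSubmodule <| StarSubalgebra.toSubalgebra ·)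
    (ContinuousMap.starSubalgebra_topologicalClosure_eq_top_of_separatesPoints _
      (expSubalgebra_separatesPoints d))

instance normVol_isOpenPosMeasure (d : ℕ) : (normVol d).IsOpenPosMeasure := by
  unfold normVol; infer_instance

instance normVol_isAddLeftInvariant (d : ℕ) : (normVol d).IsAddLeftInvariant := by
  unfold normVol; infer_instance

theorem integral_expMonomial {d : ℕ} (n : Fin d → ℤ) :
    ∫ x, expMonomial n x ∂normVol d = if n = 0 then 1 else 0 := by
  split_ifs with h
  · simp [h, expMonomial_zero]
  · unfold expMonomial normVol
    rw [integral_fintype_prod_eq_prod]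
    obtain ⟨i, hi⟩ := Function.ne_iff.mp h
    apply Finset.prod_eq_zero (Finset.mem_univ i)
    have := (orthonormal_iff_ite.mp <| orthonormal_fourier (T := 2 * π)) 0 (n i)
    rw [if_neg (fun h => hi h.symm), ContinuousMap.inner_toLp] at this
    simpa using this

/-- The class in `L²(𝕋^d, dx)` of a continuous function. -/
noncomputable abbrev toL2 {d : ℕ} (f : C(Torus d, ℂ)) : Lp ℂ 2 (normVol d) :=
  ContinuousMap.toLp (E := ℂ) 2 (normVol d) ℂ f

theorem inner_toL2 {d : ℕ} (f g : C(Torus d, ℂ)) :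
    inner ℂ (toL2 f) (toL2 g) = ∫ x, g x * conj (f x) ∂normVol d :=
  ContinuousMap.inner_toLp _ _ _

theorem orthonormal_expMap (d : ℕ) : Orthonormal ℂ fun n : Fin d → ℤ => toL2 (expMap n) := by
  rw [orthonormal_iff_ite]
  intro m n
  simp only [inner_toL2, expMap_apply, ← expMonomial_neg, ← expMonomial_add, integral_expMonomial,
    add_neg_eq_zero]
  simp [eq_comm]

theorem span_toL2_expMap_closure_eq_top (d : ℕ) :
    (span ℂ (Set.range fun n : Fin d → ℤ => toL2 (expMap n))).topologicalClosure = ⊤ := by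
  simpa only [map_span, ContinuousLinearMap.coe_coe, ← Set.range_comp, Function.comp_def] using
    (ContinuousMap.toLp_denseRange (p := 2) ℂ (normVol d) ℂ
      ENNReal.ofNat_ne_top).topologicalClosure_map_submodule (span_expMap_closure_eq_top d)

theorem toL2_injective (d : ℕ) : Function.Injective (toL2 (d := d)) :=
  ContinuousMap.toLp_injective (𝕜 := ℂ) (normVol d)

/-- In a Hilbert space, a vector with finitely many non-zero coefficients in an orthonormal basis is
the corresponding finite sum. -/
theorem eq_sum_inner_smul {E ι : Type*} [NormedAddCommGroup E] [InnerProductSpace ℂ E]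
    [CompleteSpace E] {v : ι → E} (hv : Orthonormal ℂ v)
    (hspan : (span ℂ (Set.range v)).topologicalClosure = ⊤) {x : E} {s : Finset ι}
    (hs : ∀ i, i ∉ s → inner ℂ (v i) x = 0) :
    x = ∑ i ∈ s, inner ℂ (v i) x • v i := by
  have h := (HilbertBasis.mk hv hspan.ge).hasSum_repr x
  simp only [HilbertBasis.repr_apply_apply, HilbertBasis.coe_mk] at h
  exact h.unique (hasSum_sum_of_ne_finset_zero fun i hi => by rw [hs i hi, zero_smul])

theorem norm_sum_smul_sq {E ι : Type*} [NormedAddCommGroup E] [InnerProductSpace ℂ E]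
    {v : ι → E} (hv : Orthonormal ℂ v) (s : Finset ι) (c : ι → ℂ) :
    ‖∑ i ∈ s, c i • v i‖ ^ 2 = ∑ i ∈ s, ‖c i‖ ^ 2 := by
  have h := hv.inner_sum c c s
  rw [inner_self_eq_norm_sq_to_K] at h
  have h2 : ∀ i ∈ s, conj (c i) * c i = ((‖c i‖ ^ 2 : ℝ) : ℂ) := fun i _ => by
    rw [Complex.conj_mul']; push_cast; rfl
  rw [Finset.sum_congr rfl h2, ← Complex.ofReal_sum] at h
  refine Complex.ofReal_injective (Eq.trans ?_ h)
  push_cast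
  rfl

/-- Parseval's identity for a vector with finitely many non-zero coefficients. -/
theorem sum_norm_inner_sq_eq {E ι : Type*} [NormedAddCommGroup E] [InnerProductSpace ℂ E]
    [CompleteSpace E] {v : ι → E} (hv : Orthonormal ℂ v)
    (hspan : (span ℂ (Set.range v)).topologicalClosure = ⊤) {x : E} {s : Finset ι}
    (hs : ∀ i, i ∉ s → inner ℂ (v i) x = 0) :
    ∑ i ∈ s, ‖inner ℂ (v i) x‖ ^ 2 = ‖x‖ ^ 2 := by
  conv_rhs => rw [eq_sum_inner_smul hv hspan hs, norm_sum_smul_sq hv]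

/-- A continuous function with finitely many non-zero Fourier coefficients is a trigonometric
polynomial. -/
theorem eq_sum_expMap {d : ℕ} (f : C(Torus d, ℂ)) (s : Finset (Fin d → ℤ))
    (hs : ∀ n, n ∉ s → inner ℂ (toL2 (expMap n)) (toL2 f) = 0) :
    f = ∑ n ∈ s, inner ℂ (toL2 (expMap n)) (toL2 f) • expMap n := by
  apply toL2_injective
  simp only [map_sum, map_smul]
  exact eq_sum_inner_smul (orthonormal_expMap d) (span_toL2_expMap_closure_eq_top d) hs

/-! ### Fourier support of Laplace eigenfunctions -/

/-- A function on the torus is smooth if its periodic lift to Euclidean space is. -/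
def IsSmooth {d : ℕ} (f : Torus d → ℂ) : Prop :=
  ContDiff ℝ (⊤ : ℕ∞) fun x => f (proj d x)

/-- The `i`-th partial derivative of a function on the torus, taken along the one-parameter group of
translations in the `i`-th coordinate. -/
noncomputable def partialDeriv {d : ℕ} (i : Fin d) (f : Torus d → ℂ) (x : Torus d) : ℂ :=
  deriv (fun h : ℝ => f (x + Pi.single i (h : AddCircle (2 * π)))) 0

theorem proj_isOpenQuotientMap (d : ℕ) : IsOpenQuotientMap (proj d) := by
  have h1 : IsOpenQuotientMap
      (Pi.map fun (_ : Fin d) (t : ℝ) => (t : AddCircle (2 * π))) :=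
    IsOpenQuotientMap.piMap fun _ => QuotientAddGroup.isOpenQuotientMap_mk
  exact h1.comp (PiLp.homeomorph 2 fun _ : Fin d => ℝ).isOpenQuotientMap

theorem proj_add_smul_single {d : ℕ} (x : EuclideanSpace ℝ (Fin d)) (i : Fin d) (h : ℝ) :
    proj d (x + h • EuclideanSpace.single i 1) =
      proj d x + Pi.single i (h : AddCircle (2 * π)) := by
  funext j
  by_cases hj : j = i
  · subst hj; simp [proj]
  · simp [proj, hj]

theorem IsSmooth.continuous {d : ℕ} {f : Torus d → ℂ} (hf : IsSmooth f) : Continuous f :=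
  (proj_isOpenQuotientMap d).isQuotientMap.continuous_iff.2 (ContDiff.continuous hf)

theorem IsSmooth.hasDerivAt_lift {d : ℕ} {f : Torus d → ℂ} (hf : IsSmooth f) (i : Fin d)
    (x : EuclideanSpace ℝ (Fin d)) :
    HasDerivAt (fun h : ℝ => f (proj d x + Pi.single i (h : AddCircle (2 * π))))
      (fderiv ℝ (fun y => f (proj d y)) x (EuclideanSpace.single i 1)) 0 := by
  have h1 : HasFDerivAt (fun y => f (proj d y)) (fderiv ℝ (fun y => f (proj d y)) x)
      (x + (0 : ℝ) • EuclideanSpace.single i 1) := by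
    rw [zero_smul, add_zero]
    exact (ContDiff.differentiable hf (by simp) x).hasFDerivAt
  have h2 : HasDerivAt (fun h : ℝ => x + h • EuclideanSpace.single i (1 : ℝ))
      (EuclideanSpace.single i 1) 0 := by
    simpa using ((hasDerivAt_id (0 : ℝ)).smul_const (EuclideanSpace.single i (1 : ℝ))).const_add x
  have := h1.comp_hasDerivAt (0 : ℝ) h2
  simpa only [Function.comp_def, proj_add_smul_single] using this

theorem IsSmooth.partialDeriv_proj {d : ℕ} {f : Torus d → ℂ} (hf : IsSmooth f) (i : Fin d)
    (x : EuclideanSpace ℝ (Fin d)) :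
    partialDeriv i f (proj d x) =
      fderiv ℝ (fun y => f (proj d y)) x (EuclideanSpace.single i 1) :=
  (hf.hasDerivAt_lift i x).deriv

theorem IsSmooth.hasDerivAt_zero {d : ℕ} {f : Torus d → ℂ} (hf : IsSmooth f) (i : Fin d)
    (x : Torus d) :
    HasDerivAt (fun h : ℝ => f (x + Pi.single i (h : AddCircle (2 * π))))
      (partialDeriv i f x) 0 := by
  obtain ⟨x, rfl⟩ := (proj_isOpenQuotientMap d).surjective x
  rw [hf.partialDeriv_proj]
  exact hf.hasDerivAt_lift i x

theorem IsSmooth.hasDerivAt {d : ℕ} {f : Torus d → ℂ} (hf : IsSmooth f) (i : Fin d)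
    (x : Torus d) (t : ℝ) :
    HasDerivAt (fun h : ℝ => f (x + Pi.single i (h : AddCircle (2 * π))))
      (partialDeriv i f (x + Pi.single i (t : AddCircle (2 * π)))) t := by
  have h1 := hf.hasDerivAt_zero i (x + Pi.single i (t : AddCircle (2 * π)))
  rw [← sub_self t] at h1
  have h2 := HasDerivAt.comp_sub_const t t h1
  refine h2.congr_of_eventuallyEq (Eventually.of_forall fun h => ?_)
  simp only
  rw [add_assoc, ← Pi.single_add, ← AddCircle.coe_add, add_sub_cancel]

theorem IsSmooth.partialDeriv {d : ℕ} {f : Torus d → ℂ} (hf : IsSmooth f) (i : Fin d) :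
    IsSmooth (partialDeriv i f) := by
  unfold IsSmooth
  simp_rw [hf.partialDeriv_proj]
  exact (ContDiff.fderiv_right hf (by simp)).clm_apply contDiff_const

theorem IsSmooth.mul {d : ℕ} {f g : Torus d → ℂ} (hf : IsSmooth f) (hg : IsSmooth g) :
    IsSmooth fun x => f x * g x :=
  ContDiff.mul hf hg

theorem partialDeriv_mul {d : ℕ} {f g : Torus d → ℂ} (hf : IsSmooth f) (hg : IsSmooth g)
    (i : Fin d) (x : Torus d) :
    partialDeriv i (fun x => f x * g x) x =
      partialDeriv i f x * g x + f x * partialDeriv i g x := by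
  have := ((hf.hasDerivAt_zero i x).mul (hg.hasDerivAt_zero i x)).deriv
  simp only [Pi.mul_def, AddCircle.coe_zero, Pi.single_zero, add_zero] at this
  exact this

theorem integrable_of_continuous {d : ℕ} (μ : Measure (Torus d)) [IsFiniteMeasure μ]
    {f : Torus d → ℂ} (hf : Continuous f) : Integrable f μ :=
  hf.integrable_of_hasCompactSupport (HasCompactSupport.of_compactSpace f)

theorem IsSmooth.integrable {d : ℕ} {f : Torus d → ℂ} (hf : IsSmooth f) :
    Integrable f (normVol d) :=
  integrable_of_continuous _ hf.continuous

/-- The integral of a derivative over the torus vanishes, by translation invariance. -/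
theorem integral_partialDeriv {d : ℕ} {f : Torus d → ℂ} (hf : IsSmooth f) (i : Fin d) :
    ∫ x, partialDeriv i f x ∂normVol d = 0 := by
  obtain ⟨b, hb⟩ : ∃ b, ∀ x, ‖partialDeriv i f x‖ ≤ b := by
    obtain ⟨b, hb⟩ := (isCompact_range (hf.partialDeriv i).continuous).isBounded.exists_norm_le
    exact ⟨b, fun x => hb _ ⟨x, rfl⟩⟩
  have hcont : ∀ {g : Torus d → ℂ}, Continuous g → ∀ h : ℝ,
      Integrable (fun x => g (x + Pi.single i (h : AddCircle (2 * π)))) (normVol d) :=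
    fun hg h => integrable_of_continuous _ (hg.comp (continuous_add_const _))
  set F : ℝ → Torus d → ℂ := fun h x => f (x + Pi.single i (h : AddCircle (2 * π))) with hF
  set F' : ℝ → Torus d → ℂ :=
    fun h x => partialDeriv i f (x + Pi.single i (h : AddCircle (2 * π))) with hF'
  have h1 : ∀ h, Integrable (F h) (normVol d) := hcont hf.continuous
  have h2 : ∀ h, Integrable (F' h) (normVol d) := hcont (hf.partialDeriv i).continuous
  have h3 : ∀ x h, ‖F' h x‖ ≤ b := fun x h => hb _
  have h4 : ∀ x h, HasDerivAt (fun t => F t x) (F' h x) h := fun x h => hf.hasDerivAt i x h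
  have hconst : ∀ h, ∫ x, F h x ∂normVol d = ∫ x, f x ∂normVol d := fun h =>
    integral_add_right_eq_self f _
  have hconst' : ∀ h, ∫ x, F' h x ∂normVol d = ∫ x, partialDeriv i f x ∂normVol d := fun h =>
    integral_add_right_eq_self (partialDeriv i f) _
  clear_value F F'
  have key := (hasDerivAt_integral_of_dominated_loc_of_deriv_le (μ := normVol d) (𝕜 := ℝ)
    (F := F) (F' := F') (x₀ := 0) (s := Set.univ) (bound := fun _ => b) univ_mem
    (Eventually.of_forall fun h => (h1 h).1) (h1 0) (h2 0).1
    (Eventually.of_forall fun x h _ => h3 x h) (integrable_const b)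
    (Eventually.of_forall fun x h _ => h4 x h)).2
  simp_rw [hconst] at key
  rw [← hconst' 0]
  exact key.unique (hasDerivAt_const _ _)

/-- Integration by parts on the torus. -/
theorem integral_partialDeriv_mul {d : ℕ} {f g : Torus d → ℂ} (hf : IsSmooth f) (hg : IsSmooth g)
    (i : Fin d) :
    ∫ x, f x * partialDeriv i g x ∂normVol d = -∫ x, partialDeriv i f x * g x ∂normVol d := by
  have h := integral_partialDeriv (hf.mul hg) i
  simp_rw [partialDeriv_mul hf hg] at h
  rw [integral_add ((hf.partialDeriv i).mul hg).integrable
    (hf.mul (hg.partialDeriv i)).integrable] at h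
  linear_combination h

theorem expMonomial_proj {d : ℕ} (n : Fin d → ℤ) (x : EuclideanSpace ℝ (Fin d)) :
    expMonomial n (proj d x) = ∏ i, Complex.exp (Complex.I * n i * (x i : ℝ)) := by
  unfold expMonomial proj
  refine Finset.prod_congr rfl fun i _ => ?_
  rw [fourier_coe_apply]
  congr 1
  have : (π : ℂ) ≠ 0 := by exact_mod_cast Real.pi_ne_zero
  push_cast
  field_simp

theorem isSmooth_expMonomial {d : ℕ} (n : Fin d → ℤ) : IsSmooth (expMonomial n) := by
  unfold IsSmooth
  simp_rw [expMonomial_proj]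
  refine contDiff_prod fun i _ => ContDiff.cexp ?_
  refine contDiff_const.mul (Complex.ofRealCLM.contDiff.comp ?_)
  exact (EuclideanSpace.proj (𝕜 := ℝ) i).contDiff

theorem partialDeriv_expMonomial {d : ℕ} (n : Fin d → ℤ) (i : Fin d) (x : Torus d) :
    partialDeriv i (expMonomial n) x = Complex.I * n i * expMonomial n x := by
  have h : ∀ h : ℝ, expMonomial n (x + Pi.single i (h : AddCircle (2 * π))) =
      expMonomial n x * Complex.exp (Complex.I * n i * h) := by
    intro h
    have e1 : expMonomial n (x + Pi.single i (h : AddCircle (2 * π))) =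
        expMonomial n x * expMonomial n (Pi.single i (h : AddCircle (2 * π))) := by
      simp [expMonomial, fourier_apply, AddCircle.toCircle_add, Finset.prod_mul_distrib]
    have e2 : (Pi.single i (h : AddCircle (2 * π)) : Torus d) =
        proj d (EuclideanSpace.single i h) := by
      funext j
      by_cases hj : j = i
      · subst hj; simp [proj]
      · simp [proj, hj]
    rw [e1, e2, expMonomial_proj, Finset.prod_eq_single i]
    · simp
    · intro j _ hj
      simp [hj]
    · simp
  unfold partialDeriv
  simp_rw [h]
  have h1 : HasDerivAt (fun t : ℝ => Complex.I * n i * (t : ℂ)) (Complex.I * n i) 0 := by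
    simpa using (Complex.ofRealCLM.hasDerivAt (x := (0 : ℝ))).const_mul (Complex.I * n i)
  rw [(h1.cexp.const_mul (expMonomial n x)).deriv]
  simp
  ring

theorem laplacian_lift {d : ℕ} {f : Torus d → ℂ} (hf : IsSmooth f)
    (x : EuclideanSpace ℝ (Fin d)) :
    Laplacian.laplacian (fun y => f (proj d y)) x =
      ∑ i, partialDeriv i (partialDeriv i f) (proj d x) := by
  rw [InnerProductSpace.laplacian_eq_iteratedFDeriv_orthonormalBasis _
    (EuclideanSpace.basisFun (Fin d) ℝ)]
  refine Finset.sum_congr rfl fun i _ => ?_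
  rw [(hf.partialDeriv i).partialDeriv_proj, iteratedFDeriv_two_apply]
  simp_rw [hf.partialDeriv_proj]
  have hd : DifferentiableAt ℝ (fderiv ℝ fun y => f (proj d y)) x :=
    ((ContDiff.fderiv_right (m := (⊤ : ℕ∞)) hf (by simp)).differentiable (by simp)) x
  rw [fderiv_clm_apply hd (differentiableAt_const _)]
  simp

/-- The Fourier coefficients of a Laplace eigenfunction of frequency `λ` vanish off the sphere of
radius `λ`: integrating by parts twice, `|n|² c = λ² c` for the coefficient `c` at `n`. -/
theorem inner_expMap_eq_zero {d : ℕ} {ψ : C(Torus d, ℂ)} {lam : ℝ}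
    (hψ : IsLaplaceEigenfunction ψ lam) (n : Fin d → ℤ) (hn : ∑ i, (n i : ℝ) ^ 2 ≠ lam ^ 2) :
    inner ℂ (toL2 (expMap n)) (toL2 ψ) = 0 := by
  have hs : IsSmooth ψ := hψ.1
  have he := isSmooth_expMonomial (-n)
  have hpt : ∀ x, -∑ i, partialDeriv i (partialDeriv i ψ) x = ((lam ^ 2 : ℝ) : ℂ) * ψ x := by
    intro x
    obtain ⟨x, rfl⟩ := (proj_isOpenQuotientMap d).surjective x
    rw [← laplacian_lift hs]
    exact hψ.2 x
  set c := ∫ x, expMonomial (-n) x * ψ x ∂normVol d with hc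
  have hparts : ∀ i, ∫ x, expMonomial (-n) x * partialDeriv i (partialDeriv i ψ) x ∂normVol d =
      -(n i : ℂ) ^ 2 * c := by
    intro i
    rw [integral_partialDeriv_mul he (hs.partialDeriv i)]
    simp_rw [partialDeriv_expMonomial, mul_assoc, integral_const_mul]
    rw [integral_partialDeriv_mul he hs]
    simp_rw [partialDeriv_expMonomial, mul_assoc, integral_const_mul]
    rw [← hc]
    push_cast [Pi.neg_apply]
    linear_combination (n i : ℂ) ^ 2 * c * Complex.I_sq
  have key : ((∑ i, (n i : ℝ) ^ 2 : ℝ) : ℂ) * c = ((lam ^ 2 : ℝ) : ℂ) * c := by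
    calc ((∑ i, (n i : ℝ) ^ 2 : ℝ) : ℂ) * c
        = -∑ i, ∫ x, expMonomial (-n) x * partialDeriv i (partialDeriv i ψ) x ∂normVol d := by
          simp_rw [hparts]
          push_cast
          rw [Finset.sum_mul, ← Finset.sum_neg_distrib]
          exact Finset.sum_congr rfl fun i _ => by ring
      _ = ∫ x, expMonomial (-n) x * -∑ i, partialDeriv i (partialDeriv i ψ) x ∂normVol d := by
          rw [← integral_finsetSum _ fun i _ =>
            (he.mul ((hs.partialDeriv i).partialDeriv i)).integrable, ← integral_neg]
          simp_rw [mul_neg, Finset.mul_sum]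
      _ = ((lam ^ 2 : ℝ) : ℂ) * c := by
          simp_rw [hpt, hc, ← integral_const_mul]
          exact integral_congr_ae (Eventually.of_forall fun x => by ring)
  have hc0 : c = 0 := by
    by_contra h
    exact hn (by exact_mod_cast mul_right_cancel₀ h key)
  rw [inner_toL2, ← hc0, hc]
  refine integral_congr_ae (Eventually.of_forall fun x => ?_)
  simp only [expMap_apply, expMonomial_neg, mul_comm]

/-! ### The variance of matrix elements -/

section Counting

variable {d : ℕ} {ψ : ℕ → C(Torus d, ℂ)} {lam : ℕ → ℝ}

theorem IsEigenbasis.inner_eq_zero (hψ : IsEigenbasis ψ lam) {n : Fin d → ℤ} {j : ℕ}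
    (h : ∑ i, (n i : ℝ) ^ 2 ≠ lam j ^ 2) : inner ℂ (toL2 (expMap n)) (toL2 (ψ j)) = 0 :=
  inner_expMap_eq_zero (hψ.eigen j) n h

/-- A lower bound in Weyl's law: the exponentials of frequency less than `R` are combinations of
the eigenfunctions of frequency less than `R`, and a small cube already has enough of them. -/
theorem IsEigenbasis.pow_le_index (hd : 1 ≤ d) (hψ : IsEigenbasis ψ lam) {P J : ℕ}
    (hP : (P : ℝ) ≤ lam J) : ((P : ℝ) / d) ^ d ≤ J := by
  classical
  rcases Nat.eq_zero_or_pos P with rfl | hP0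
  · simp [show d ≠ 0 by omega]
  have hd0 : (0 : ℝ) < d := by exact_mod_cast hd
  have hP0' : (0 : ℝ) < P := by exact_mod_cast hP0
  set B : ℕ := ⌈(P : ℝ) / d⌉₊ with hB
  -- a cube of lattice points `n` with `|n| < P`
  set Q : Finset (Fin d → ℤ) := Fintype.piFinset fun _ => Finset.Ico (0 : ℤ) B with hQ
  have hcard : Q.card = B ^ d := by simp [hQ]
  have hlt : ∀ n ∈ Q, ∑ i, (n i : ℝ) ^ 2 < (P : ℝ) ^ 2 := by
    intro n hn
    have hn' : ∀ i, (n i : ℝ) ^ 2 < ((P : ℝ) / d) ^ 2 := by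
      intro i
      have h1 := Finset.mem_Ico.1 (Fintype.mem_piFinset.1 hn i)
      have h2 : (0 : ℝ) ≤ n i := by exact_mod_cast h1.1
      have h3 : (n i : ℝ) + 1 ≤ B := by exact_mod_cast h1.2
      have h4 := Nat.ceil_lt_add_one (div_nonneg hP0'.le hd0.le)
      rw [← hB] at h4
      gcongr
      linarith
    have : NeZero d := ⟨by omega⟩
    calc ∑ i, (n i : ℝ) ^ 2 < ∑ _i : Fin d, ((P : ℝ) / d) ^ 2 :=
          Finset.sum_lt_sum_of_nonempty Finset.univ_nonempty fun i _ => hn' i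
      _ = (P : ℝ) ^ 2 / d := by
          rw [Finset.sum_const, Finset.card_univ, Fintype.card_fin, nsmul_eq_mul]
          field_simp
      _ ≤ (P : ℝ) ^ 2 := div_le_self (by positivity) (by exact_mod_cast hd)
  have hzero : ∀ n ∈ Q, ∀ j, j ∉ Finset.range J →
      inner ℂ (toL2 (ψ j)) (toL2 (expMap n)) = 0 := by
    intro n hn j hj
    rw [← inner_conj_symm, hψ.inner_eq_zero, map_zero]
    have h1 : (P : ℝ) ≤ lam j := hP.trans (hψ.mono (by simpa using hj))
    have h2 : (P : ℝ) ^ 2 ≤ lam j ^ 2 := by gcongr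
    exact ((hlt n hn).trans_le h2).ne
  have hle : (Q.card : ℝ) ≤ J := by
    calc (Q.card : ℝ) = ∑ n ∈ Q, ‖toL2 (expMap n)‖ ^ 2 := by
          simp [(orthonormal_expMap d).1]
      _ = ∑ n ∈ Q, ∑ j ∈ Finset.range J, ‖inner ℂ (toL2 (ψ j)) (toL2 (expMap n))‖ ^ 2 :=
          Finset.sum_congr rfl fun n hn =>
            (sum_norm_inner_sq_eq hψ.orthonormal hψ.complete (hzero n hn)).symm
      _ = ∑ j ∈ Finset.range J, ∑ n ∈ Q, ‖inner ℂ (toL2 (expMap n)) (toL2 (ψ j))‖ ^ 2 := by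
          rw [Finset.sum_comm]
          simp_rw [norm_inner_symm]
      _ ≤ ∑ j ∈ Finset.range J, ‖toL2 (ψ j)‖ ^ 2 :=
          Finset.sum_le_sum fun j _ => (orthonormal_expMap d).sum_inner_products_le _
      _ = J := by
          have : ∀ j, ‖toL2 (ψ j)‖ = 1 := hψ.orthonormal.1
          simp [this]
  calc ((P : ℝ) / d) ^ d ≤ (B : ℝ) ^ d := by gcongr; exact Nat.le_ceil _
    _ = Q.card := by rw [hcard]; push_cast; rfl
    _ ≤ J := hle

/-- The variance of the diagonal matrix elements of `e_l` is at most the squared Hilbert–Schmidt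
norm of the off-diagonal part, in the basis of exponentials, of the compression of `e_l dμ` to the
eigenspaces. -/
theorem IsEigenbasis.sum_variance_le (hψ : IsEigenbasis ψ lam) (μ : Measure (Torus d))
    [IsProbabilityMeasure μ] (l : Fin d → ℤ) {N P : ℕ} (hP : ∀ j < N, lam j < P + 1) :
    ∑ j ∈ Finset.range N,
        ‖∫ x, expMonomial l x * ((‖ψ j x‖ ^ 2 : ℝ) : ℂ) ∂μ - ∫ x, expMonomial l x ∂μ‖ ^ 2 ≤
      ∑ n ∈ box d P, ∑ m ∈ box d P,
        (if n ≠ m ∧ ∑ i, n i ^ 2 = ∑ i, m i ^ 2 then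
          ‖fourierCoeffMeasure μ (n - m - l)‖ ^ 2 else 0) := by
  classical
  set M : (Fin d → ℤ) → (Fin d → ℤ) → ℂ := fun n m =>
    if n ≠ m ∧ ∑ i, n i ^ 2 = ∑ i, m i ^ 2 then fourierCoeffMeasure μ (n - m - l) else 0 with hM
  set t : (Fin d → ℤ) → Lp ℂ 2 (normVol d) := fun n =>
    ∑ m ∈ box d P, conj (M n m) • toL2 (expMap m) with ht
  have hmain : ∀ j ∈ Finset.range N,
      ‖∫ x, expMonomial l x * ((‖ψ j x‖ ^ 2 : ℝ) : ℂ) ∂μ - ∫ x, expMonomial l x ∂μ‖ ^ 2 ≤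
        ∑ n ∈ box d P, ‖inner ℂ (toL2 (ψ j)) (t n)‖ ^ 2 := by
    intro j hj
    set c : (Fin d → ℤ) → ℂ := fun n => inner ℂ (toL2 (expMap n)) (toL2 (ψ j)) with hc
    have hsupp : ∀ n, n ∉ box d P → c n = 0 := by
      intro n hn
      refine hψ.inner_eq_zero (ne_of_gt ?_)
      simp only [mem_box, not_forall, not_le] at hn
      obtain ⟨i, hi⟩ := hn
      have h1 : (P : ℝ) + 1 ≤ |(n i : ℝ)| := by exact_mod_cast hi
      have h2 := hP j (Finset.mem_range.1 hj)
      have h3 := hψ.nonneg j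
      calc lam j ^ 2 < |(n i : ℝ)| ^ 2 := by gcongr; linarith
        _ = (n i : ℝ) ^ 2 := sq_abs _
        _ ≤ ∑ i, (n i : ℝ) ^ 2 :=
          Finset.single_le_sum (f := fun i => (n i : ℝ) ^ 2) (fun i _ => sq_nonneg _)
            (Finset.mem_univ i)
    have hnorm : ∑ n ∈ box d P, ‖c n‖ ^ 2 = 1 := by
      rw [sum_norm_inner_sq_eq (orthonormal_expMap d) (span_toL2_expMap_closure_eq_top d) hsupp]
      have : ‖toL2 (ψ j)‖ = 1 := hψ.orthonormal.1 j
      rw [this, one_pow]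
    have hpt : ∀ x, ψ j x = ∑ n ∈ box d P, c n * expMonomial n x := by
      intro x
      have := congrArg (fun f : C(Torus d, ℂ) => f x) (eq_sum_expMap (ψ j) (box d P) hsupp)
      simpa [ContinuousMap.sum_apply, hc] using this
    have hexpand : ∀ x, expMonomial l x * ((‖ψ j x‖ ^ 2 : ℝ) : ℂ) =
        ∑ n ∈ box d P, ∑ m ∈ box d P,
          conj (c n) * c m * expMonomial (-(n - m - l)) x := by
      intro x
      have e : ((‖ψ j x‖ ^ 2 : ℝ) : ℂ) = conj (ψ j x) * ψ j x := by
        rw [Complex.conj_mul']; push_cast; rfl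
      rw [e, hpt x, map_sum, Finset.sum_mul_sum, Finset.mul_sum]
      refine Finset.sum_congr rfl fun n _ => ?_
      rw [Finset.mul_sum]
      refine Finset.sum_congr rfl fun m _ => ?_
      rw [show -(n - m - l) = l + (-n + m) by abel, expMonomial_add, expMonomial_add,
        expMonomial_neg, map_mul]
      ring
    have hint : ∫ x, expMonomial l x * ((‖ψ j x‖ ^ 2 : ℝ) : ℂ) ∂μ =
        ∑ n ∈ box d P, ∑ m ∈ box d P, conj (c n) * c m * fourierCoeffMeasure μ (n - m - l) := by
      have hi : ∀ n m : Fin d → ℤ, Integrable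
          (fun x => conj (c n) * c m * expMonomial (-(n - m - l)) x) μ := fun n m =>
        (integrable_of_continuous μ (expMap (-(n - m - l))).continuous).const_mul _
      simp_rw [hexpand]
      rw [integral_finsetSum _ fun n _ => integrable_finsetSum _ fun m _ => hi n m]
      refine Finset.sum_congr rfl fun n _ => ?_
      rw [integral_finsetSum _ fun m _ => hi n m]
      exact Finset.sum_congr rfl fun m _ => integral_const_mul _ _
    -- the coefficients `c` live on one sphere, so that only pairs of equal norm contribute
    have hsplit : ∀ n ∈ box d P, ∀ m ∈ box d P,
        conj (c n) * c m * fourierCoeffMeasure μ (n - m - l) =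
          conj (c n) * (M n m * c m) +
            if n = m then ((‖c n‖ ^ 2 : ℝ) : ℂ) * ∫ x, expMonomial l x ∂μ else 0 := by
      intro n _ m _
      by_cases hnm : n = m
      · subst hnm
        have e : ((‖c n‖ ^ 2 : ℝ) : ℂ) = conj (c n) * c n := by
          rw [Complex.conj_mul']; push_cast; rfl
        simp [hM, e, fourierCoeffMeasure]
      · by_cases heq : ∑ i, n i ^ 2 = ∑ i, m i ^ 2
        · simp only [hM, if_pos (And.intro hnm heq), if_neg hnm]
          ring
        · have hzero : c n = 0 ∨ c m = 0 := by
            by_contra! hcon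
            have h1 : ∑ i, (n i : ℝ) ^ 2 = lam j ^ 2 := by
              by_contra h; exact hcon.1 (hψ.inner_eq_zero h)
            have h2 : ∑ i, (m i : ℝ) ^ 2 = lam j ^ 2 := by
              by_contra h; exact hcon.2 (hψ.inner_eq_zero h)
            exact heq (by exact_mod_cast h1.trans h2.symm)
          rcases hzero with h | h <;> simp [h, hnm]
    have hdiff : ∫ x, expMonomial l x * ((‖ψ j x‖ ^ 2 : ℝ) : ℂ) ∂μ - ∫ x, expMonomial l x ∂μ =
        ∑ n ∈ box d P, conj (c n) * ∑ m ∈ box d P, M n m * c m := by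
      rw [hint, Finset.sum_congr rfl fun n hn => Finset.sum_congr rfl (hsplit n hn)]
      simp_rw [Finset.sum_add_distrib, Finset.mul_sum]
      rw [add_sub_assoc, add_eq_left, sub_eq_zero]
      rw [Finset.sum_congr rfl (g := fun n => ((‖c n‖ ^ 2 : ℝ) : ℂ) * ∫ x, expMonomial l x ∂μ)]
      · rw [← Finset.sum_mul, ← Complex.ofReal_sum, hnorm, Complex.ofReal_one, one_mul]
      · intro n hn
        rw [Finset.sum_ite_eq, if_pos hn]
    have hinner : ∀ n, ‖inner ℂ (toL2 (ψ j)) (t n)‖ = ‖∑ m ∈ box d P, M n m * c m‖ := by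
      intro n
      rw [norm_inner_symm, ht, sum_inner]
      simp_rw [inner_smul_left, Complex.conj_conj]
      rfl
    simp_rw [hinner]
    rw [hdiff]
    calc ‖∑ n ∈ box d P, conj (c n) * ∑ m ∈ box d P, M n m * c m‖ ^ 2
        ≤ (∑ n ∈ box d P, ‖c n‖ * ‖∑ m ∈ box d P, M n m * c m‖) ^ 2 := by
          gcongr
          refine (norm_sum_le _ _).trans_eq ?_
          simp_rw [norm_mul, RCLike.norm_conj]
      _ ≤ (∑ n ∈ box d P, ‖c n‖ ^ 2) * ∑ n ∈ box d P, ‖∑ m ∈ box d P, M n m * c m‖ ^ 2 :=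
          Finset.sum_mul_sq_le_sq_mul_sq _ _ _
      _ = _ := by rw [hnorm, one_mul]
  calc _ ≤ ∑ j ∈ Finset.range N, ∑ n ∈ box d P, ‖inner ℂ (toL2 (ψ j)) (t n)‖ ^ 2 :=
        Finset.sum_le_sum hmain
    _ = ∑ n ∈ box d P, ∑ j ∈ Finset.range N, ‖inner ℂ (toL2 (ψ j)) (t n)‖ ^ 2 :=
        Finset.sum_comm
    _ ≤ ∑ n ∈ box d P, ‖t n‖ ^ 2 :=
        Finset.sum_le_sum fun n _ => hψ.orthonormal.sum_inner_products_le _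
    _ = _ := by
        refine Finset.sum_congr rfl fun n _ => ?_
        rw [ht, norm_sum_smul_sq (orthonormal_expMap d)]
        refine Finset.sum_congr rfl fun m _ => ?_
        rw [RCLike.norm_conj, hM]
        simp only
        split_ifs <;> simp

end Counting

theorem norm_fourierCoeffMeasure_le_one {d : ℕ} (μ : Measure (Torus d)) [IsProbabilityMeasure μ]
    (n : Fin d → ℤ) : ‖fourierCoeffMeasure μ n‖ ≤ 1 := by
  have := norm_integral_le_of_norm_le_const (μ := μ) (f := expMonomial (-n)) (C := 1)
    (Eventually.of_forall fun x => (norm_expMonomial (-n) x).le)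
  simpa [fourierCoeffMeasure] using this

theorem abs_coord_le_latticeNorm {d : ℕ} (n : Fin d → ℤ) (i : Fin d) :
    |(n i : ℝ)| ≤ latticeNorm n :=
  Real.abs_le_sqrt (Finset.single_le_sum (f := fun i => (n i : ℝ) ^ 2)
    (fun _ _ => sq_nonneg _) (Finset.mem_univ i))

/-- Polynomial decay of the Fourier coefficients is not affected by a translation. -/
theorem fourier_decay_translate {d : ℕ} (μ : Measure (Torus d)) [IsProbabilityMeasure μ]
    {α C : ℝ} (hα : 0 ≤ α) (hC : 0 ≤ C)
    (hμ : ∀ n : Fin d → ℤ, n ≠ 0 → ‖fourierCoeffMeasure μ n‖ ^ 2 ≤ C * latticeNorm n ^ (-α))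
    (l : Fin d → ℤ) :
    ∃ A : ℝ, 0 ≤ A ∧ ∀ (k : Fin d → ℤ) (j : Fin d), k j ≠ 0 →
      ‖fourierCoeffMeasure μ (k - l)‖ ^ 2 ≤ A * |(k j : ℝ)| ^ (-α) := by
  have hl0 : 0 ≤ latticeNorm l := Real.sqrt_nonneg _
  refine ⟨C * 2 ^ α + (2 * latticeNorm l) ^ α, by positivity, fun k j hj => ?_⟩
  have hpos : 0 < |(k j : ℝ)| := abs_pos.2 (by exact_mod_cast hj)
  have hr : 0 ≤ |(k j : ℝ)| ^ (-α) := by positivity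
  rw [add_mul]
  rcases le_total (2 * latticeNorm l) |(k j : ℝ)| with h | h
  · have h1 : |(k j : ℝ)| / 2 ≤ |((k - l) j : ℝ)| := by
      have h2 := abs_coord_le_latticeNorm l j
      have h3 := abs_sub_abs_le_abs_sub (k j : ℝ) (l j)
      rw [Pi.sub_apply, Int.cast_sub]
      linarith
    have hne : k - l ≠ 0 := by
      intro h0
      rw [h0] at h1
      simp only [Pi.zero_apply, Int.cast_zero, abs_zero] at h1
      linarith
    have h4 : latticeNorm (k - l) ^ (-α) ≤ (|(k j : ℝ)| / 2) ^ (-α) :=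
      Real.rpow_le_rpow_of_nonpos (by positivity)
        (h1.trans (abs_coord_le_latticeNorm (k - l) j)) (by linarith)
    have h5 : (|(k j : ℝ)| / 2) ^ (-α) = 2 ^ α * |(k j : ℝ)| ^ (-α) := by
      rw [Real.div_rpow hpos.le zero_le_two, Real.rpow_neg zero_le_two, div_inv_eq_mul, mul_comm]
    calc _ ≤ C * latticeNorm (k - l) ^ (-α) := hμ _ hne
      _ ≤ C * (2 ^ α * |(k j : ℝ)| ^ (-α)) := by rw [← h5]; gcongr
      _ ≤ _ := by
          rw [← mul_assoc]
          exact le_add_of_nonneg_right (by positivity)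
  · calc ‖fourierCoeffMeasure μ (k - l)‖ ^ 2 ≤ 1 :=
          pow_le_one₀ (norm_nonneg _) (norm_fourierCoeffMeasure_le_one μ _)
      _ = |(k j : ℝ)| ^ α * |(k j : ℝ)| ^ (-α) := by
          rw [← Real.rpow_add hpos, add_neg_cancel, Real.rpow_zero]
      _ ≤ (2 * latticeNorm l) ^ α * |(k j : ℝ)| ^ (-α) := by gcongr
      _ ≤ _ := le_add_of_nonneg_left (by positivity)

/-- Quantum ergodicity in the mean: the variance of the matrix elements of an exponential is
`o(N)` over the first `N` eigenfunctions. -/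
theorem cesaro_variance_tendsto {d : ℕ} (hd : 2 ≤ d) (μ : Measure (Torus d))
    [IsProbabilityMeasure μ] {α C : ℝ} (hα : (d : ℝ) - 2 < α) (hC : 0 ≤ C)
    (hμ : ∀ n : Fin d → ℤ, n ≠ 0 → ‖fourierCoeffMeasure μ n‖ ^ 2 ≤ C * latticeNorm n ^ (-α))
    {ψ : ℕ → C(Torus d, ℂ)} {lam : ℕ → ℝ} (hψ : IsEigenbasis ψ lam) (l : Fin d → ℤ) :
    Tendsto (fun N : ℕ => (∑ j ∈ Finset.range N,
      ‖∫ x, expMonomial l x * ((‖ψ j x‖ ^ 2 : ℝ) : ℂ) ∂μ - ∫ x, expMonomial l x ∂μ‖ ^ 2) / N)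
      atTop (𝓝 0) := by
  have hd' : (2 : ℝ) ≤ d := by exact_mod_cast hd
  obtain ⟨A, hA0, hA⟩ := fourier_decay_translate μ (by linarith) hC hμ l
  rw [Metric.tendsto_atTop]
  intro ε hε
  obtain ⟨D, hD0, hD⟩ := sum_equal_norm_pairs_le hd hα hA0
    (v := fun k => ‖fourierCoeffMeasure μ (k - l)‖ ^ 2) (fun k => sq_nonneg _)
    (fun k j hj _ => hA k j hj) (η := ε / (4 * (d : ℝ) ^ d)) (by positivity)
  obtain ⟨N₀, hN₀⟩ := exists_nat_gt (2 * D / ε)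
  refine ⟨N₀ + 1, fun N hN => ?_⟩
  have hN1 : (0 : ℝ) < N := by
    have : 0 < N := by omega
    exact_mod_cast this
  have hND : D < ε / 2 * N := by
    have : (N₀ : ℝ) ≤ N := by exact_mod_cast (by omega : N₀ ≤ N)
    have := hN₀.trans_le this
    rw [div_lt_iff₀ hε] at this
    linarith
  set P := ⌊lam (N - 1)⌋₊ with hPdef
  have hfl : (P : ℝ) ≤ lam (N - 1) := Nat.floor_le (hψ.nonneg _)
  have hvar := hψ.sum_variance_le μ l (N := N) (P := P) fun j hj =>
    (hψ.mono (by omega)).trans_lt (Nat.lt_floor_add_one _)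
  have hcount : (P : ℝ) ^ d ≤ (d : ℝ) ^ d * N := by
    have h1 := hψ.pow_le_index (by omega) hfl
    rw [div_pow, div_le_iff₀ (by positivity)] at h1
    refine h1.trans ?_
    rw [mul_comm]
    gcongr
    omega
  have hsum := hvar.trans (hD P)
  rw [Real.dist_eq, sub_zero, abs_of_nonneg (by positivity), div_lt_iff₀ hN1]
  calc _ ≤ _ := hsum
    _ ≤ ε / (4 * (d : ℝ) ^ d) * ((d : ℝ) ^ d * N) + D := by gcongr
    _ = ε / 4 * N + D := by field_simp
    _ < ε * N := by nlinarith

/-- Convergence of `∫ a |ψ_j|² dμ` for the exponentials implies it for all continuous functions. -/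
theorem tendsto_integral_of_expMonomial {d : ℕ} {μ : Measure (Torus d)} [IsProbabilityMeasure μ]
    {ψ : ℕ → C(Torus d, ℂ)} {F : Filter ℕ}
    (h : ∀ l : Fin d → ℤ, Tendsto (fun j => ∫ x, expMonomial l x * ((‖ψ j x‖ ^ 2 : ℝ) : ℂ) ∂μ) F
      (𝓝 (∫ x, expMonomial l x ∂μ))) (a : C(Torus d, ℂ)) :
    Tendsto (fun j => ∫ x, a x * ((‖ψ j x‖ ^ 2 : ℝ) : ℂ) ∂μ) F (𝓝 (∫ x, a x ∂μ)) := by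
  have hint : ∀ (b : C(Torus d, ℂ)) j,
      Integrable (fun x => b x * ((‖ψ j x‖ ^ 2 : ℝ) : ℂ)) μ := fun b j =>
    integrable_of_continuous μ (by fun_prop)
  have hint' : ∀ b : C(Torus d, ℂ), Integrable (fun x => b x) μ := fun b =>
    integrable_of_continuous μ b.continuous
  have hspan : ∀ b ∈ Submodule.span ℂ (Set.range (expMap (d := d))),
      Tendsto (fun j => ∫ x, b x * ((‖ψ j x‖ ^ 2 : ℝ) : ℂ) ∂μ) F (𝓝 (∫ x, b x ∂μ)) := by
    intro b hb
    induction hb using Submodule.span_induction with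
    | mem b hb => obtain ⟨n, rfl⟩ := hb; exact h n
    | zero => simpa using tendsto_const_nhds
    | add b b' _ _ h1 h2 =>
      simp only [ContinuousMap.add_apply, add_mul]
      simp_rw [integral_add (hint b _) (hint b' _)]
      rw [integral_add (hint' b) (hint' b')]
      exact h1.add h2
    | smul c b _ h =>
      simp only [ContinuousMap.smul_apply, smul_eq_mul, mul_assoc, integral_const_mul]
      exact h.const_mul c
  -- the total masses `∫ |ψ_j|² dμ` are eventually bounded
  have hmass : ∀ᶠ j in F, ∫ x, ‖ψ j x‖ ^ 2 ∂μ ≤ 2 := by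
    have h0 := (h 0).norm
    simp only [expMonomial_zero, one_mul, integral_const, probReal_univ, one_smul, norm_one] at h0
    filter_upwards [h0.eventually (ge_mem_nhds one_lt_two)] with j hj
    rw [integral_complex_ofReal, Complex.norm_real] at hj
    exact (Real.le_norm_self _).trans hj
  rw [Metric.tendsto_nhds]
  intro ε hε
  have ha : a ∈ closure (Submodule.span ℂ (Set.range (expMap (d := d))) : Set C(Torus d, ℂ)) := by
    rw [← Submodule.topologicalClosure_coe, span_expMap_closure_eq_top]
    trivial
  obtain ⟨b, hb, hab⟩ := Metric.mem_closure_iff.1 ha (ε / 4) (by positivity)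
  rw [dist_eq_norm] at hab
  filter_upwards [hmass, Metric.tendsto_nhds.1 (hspan b hb) (ε / 4) (by positivity)] with j hj1 hj2
  rw [dist_eq_norm] at hj2 ⊢
  have hle : ∀ x, ‖a x - b x‖ ≤ ‖a - b‖ := fun x => (a - b).norm_coe_le_norm x
  have e1 : ‖∫ x, a x * ((‖ψ j x‖ ^ 2 : ℝ) : ℂ) ∂μ - ∫ x, b x * ((‖ψ j x‖ ^ 2 : ℝ) : ℂ) ∂μ‖ ≤
      ‖a - b‖ * 2 := by
    rw [← integral_sub (hint a j) (hint b j)]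
    have hi : Integrable (fun x => ‖a - b‖ * ‖ψ j x‖ ^ 2) μ :=
      Continuous.integrable_of_hasCompactSupport (by fun_prop) (HasCompactSupport.of_compactSpace _)
    refine (norm_integral_le_of_norm_le hi (Eventually.of_forall fun x => ?_)).trans ?_
    · rw [← sub_mul, norm_mul, Complex.norm_real, Real.norm_of_nonneg (sq_nonneg _)]
      gcongr
      exact hle x
    · rw [integral_const_mul]
      gcongr
  have e2 : ‖∫ x, b x ∂μ - ∫ x, a x ∂μ‖ ≤ ‖a - b‖ := by
    rw [norm_sub_rev, ← integral_sub (hint' a) (hint' b)]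
    have := norm_integral_le_of_norm_le_const (μ := μ) (Eventually.of_forall hle)
    simpa using this
  calc _ = ‖(∫ x, a x * ((‖ψ j x‖ ^ 2 : ℝ) : ℂ) ∂μ - ∫ x, b x * ((‖ψ j x‖ ^ 2 : ℝ) : ℂ) ∂μ) +
        (∫ x, b x * ((‖ψ j x‖ ^ 2 : ℝ) : ℂ) ∂μ - ∫ x, b x ∂μ) +
        (∫ x, b x ∂μ - ∫ x, a x ∂μ)‖ := by congr 1; ring
    _ ≤ _ := norm_add₃_le
    _ < ε := by linarith

end ToralQE

theorem corollary2p8 (d : ℕ) (hd : 2 ≤ d)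
    (μ : Measure (ToralQE.Torus d)) [IsProbabilityMeasure μ]
    (α C : ℝ) (hα : (d : ℝ) - 2 < α) (hC : 0 < C)
    (hμ : ∀ n : Fin d → ℤ, n ≠ 0 →
      ‖ToralQE.fourierCoeffMeasure μ n‖ ^ 2 ≤ C * ToralQE.latticeNorm n ^ (-α))
    (ψ : ℕ → C(ToralQE.Torus d, ℂ)) (lam : ℕ → ℝ) (hψ : ToralQE.IsEigenbasis ψ lam) :
    ∃ S : Set ℕ, ToralQE.HasDensityOne S ∧
      ∀ a : C(ToralQE.Torus d, ℂ),
        Tendsto (fun j => ∫ x, a x * ((‖ψ j x‖ ^ 2 : ℝ) : ℂ) ∂μ) (atTop ⊓ 𝓟 S)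
          (𝓝 (∫ x, a x ∂μ)) := by
  obtain ⟨S, hS, h⟩ := ToralQE.exists_densityOne_of_forall_cesaro (fun l j => sq_nonneg _)
    (ToralQE.cesaro_variance_tendsto hd μ hα hC.le hμ hψ)
  refine ⟨S, hS, ToralQE.tendsto_integral_of_expMonomial fun l => ?_⟩
  rw [tendsto_iff_norm_sub_tendsto_zero]
  have := (Real.continuous_sqrt.tendsto 0).comp (h l)
  rw [Real.sqrt_zero] at this
  exact this.congr fun j => Real.sqrt_sq (norm_nonneg _)
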